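/- Let $K$ be an algebraic extension of $\mathbb{Q}_2$ with discrete valuation (for instance a finite extension), $\mathcal{O}_K$ its ring of integers, $\pi$ a uniformizer and $e$ the ramification index, so that $2\mathcal{O}_K=\pi^e\mathcal{O}_K$; write $v_2$ for the valuation with $v_2(2)=1$. For $M\in\frac1e\mathbb{N}$ write $2^M$ for $\pi^{eM}$. **Fixed point arithmetic at precision $O(2^M)$.** Numbers are elements of $\mathcal{O}_K/\pi^{eM}\mathcal{O}_K$, added, subtracted and multiplied in this ring. Put $v_2(0)=M$, and $v_2(x)=v_2(\hat x)$ for any lift $\hat x\in\mathcal{O}_K$ of $x\ne0$. The division of $x$ by $y$ raises an error if $v_2(y)>v_2(x)$; otherwise it returns $0$ if $x=0$, and an arbitrary $w$ with $x=yw$ if $x\neq 0$. A computation stays inside $\mathcal{O}_K$ when no division raises an error. **Assumptions.** Let $U,V\in K[[t]]$ satisfy - $(\mathrm{H}_U)$: $U=t(t-4a)\,u(t)^2$ with $a\in\mathcal{O}_K^\times$, $u\in\mathcal{O}_K[[t]]$, $u(0)\in\mathcal{O}_K^\times$; - $(\mathrm{H}_V)$: $V=t(t-4b)\,v(t)^2$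 with $b\in\mathcal{O}_K^\times$, $v\in\mathcal{O}_K[[t]]$, $v(0)\in\mathcal{O}_K^\times$. **Algorithms.** $\mathtt{LinDiffSolve}(a,f,n)$ returns $\sum_{i<n}y_it^i$, where $y_0=\frac{-f_0}{2a}$ and $y_i=\frac{i\,y_{i-1}-f_i}{2a(2i+1)}$ for $1\le i<n$. $\mathtt{DiffSolve}(a,u,u^2,u^{-3},b,v^2,n)$ returns a pair $(q_n,r_n)$. For $n=0$ it returns $(0,0)$. For $n=1$ it computes $\lambda=b/a$ and $z_1=\frac{b\,v(0)^2}{a\,u(0)^2}$ and returns $\left(\frac{\lambda-z_1}{4a},\ \frac1{z_1^2}\right)$. For $n\ge2$ it puts $m=\lceil n/2\rceil$, obtains $(q_m,r_m)$ by a recursive call, and computes $$\lambda=b/a,\qquad z_m=\lambda t+t(t-4a)q_m \bmod t^{n+1},\qquad w_n=z_m'^2\bmod t^n,$$ $$s_n=W(t,q_m)-u^2w_n\bmod t^n,\qquad r_n=r_m(2-r_mw_n)\bmod t^{m},$$ $$f_n=(2^{-1}s_n)\,r_n\,u^{-3}\bmod t^n,\qquad y_n=\mathtt{LinDiffSolve}(a,f_n,n),$$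 where $W(t,x)=(\lambda+(t-4a)x)(\lambda+tx)\,v^2(\lambda t+t(t-4a)x)$, and returns $(q_m+z_m'\,u\,y_n\bmod t^n,\ r_n)$. $\mathtt{IsoSolve}(U,V,n)$ takes $a,b,u,v$ as in $(\mathrm{H}_U)$, $(\mathrm{H}_V)$; represents at precision $O(2^M)$ the numbers $a,b$, the series $u^2,v^2$ modulo $t^{n-1}$ and the series $u,u^{-3}$ modulo $t^{\lceil (n-1)/2\rceil}$; calls $\mathtt{DiffSolve}(a,u,u^2,u^{-3},b,v^2,n-1)$, whose first component is $q$; and returns $\frac ba\,t+t(t-4a)\,q \bmod t^n$. **Theorem.** Let $n\ge1$ be an integer, $N\in\frac1e\mathbb{N}$, and assume $(\mathrm{H}_U)$, $(\mathrm{H}_V)$ and that the unique nonzero solution $z\in tK[[t]]$ of $U\cdot z'^2=V(z)$ has coefficients in $\mathcal{O}_K$. When $\mathtt{IsoSolve}(U,V,n)$ is run in fixed point arithmetic at precision $O(2^M)$ with $$M=\max(N,3)+\lfloor\log_2 n\rfloor+2,$$ then, whatever values the divisions return among the admissible ones, no error is raised, so every computation is performed inside $\mathcal{O}_K$, and the output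 is congruent to $z$ modulo $(2^N,t^n)$. -/

import Mathlib

open scoped PowerSeries

noncomputable section

/-! ### Executions

A computation is given by the set of its possible outcomes: `none` stands for an execution that
raises an error, `some x` for one that returns `x`. There may be several outcomes because a
division in fixed point arithmetic may return any admissible quotient. -/

/-- Computations, as sets of possible outcomes. -/
def Run (α : Type*) := Set (Option α)

namespace Run

/-- `o` is a possible outcome of the computation `m`. -/
def HasOutcome {α : Type*} (m : Run α) (o : Option α) : Prop := m o

/-- Sequential composition; an error aborts the execution. -/
def andThen {α β : Type*} (m : Run α) (f : α → Run β) : Run β :=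
  fun o => (m.HasOutcome none ∧ o = none) ∨ ∃ x, m.HasOutcome (some x) ∧ (f x).HasOutcome o

/-- The computation that returns `x`. -/
def ret {α : Type*} (x : α) : Run α := fun o => o = some x

/-- The computation that raises an error. -/
def error {α : Type*} : Run α := fun o => o = none

/-- The computation that returns an arbitrary element of the set `s`. -/
def choose {α : Type*} (s : Set α) : Run α := fun o => ∃ x ∈ s, o = some x

instance : Monad Run where
  pure := ret
  bind := andThen

end Run

/-! ### Fixed point arithmetic

Below, `A` is the ring of integers, `ϖ` a uniformizer, and `k` is the working precision counted in
powers of `ϖ` (so `k = e * M` for the precision `O(2^M)`). -/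

/-- The numbers of the fixed point arithmetic model. Additions, subtractions and
multiplications are those of this quotient ring. -/
abbrev Fixed (A : Type*) [CommRing A] (ϖ : A) (k : ℕ) := A ⧸ Ideal.span {ϖ ^ k}

section FixedPoint

variable {A : Type*} [CommRing A] {ϖ : A} {k : ℕ}

/-- Reduction of an integral element at the working precision. -/
abbrev reduce (ϖ : A) (k : ℕ) : A →+* Fixed A ϖ k := Ideal.Quotient.mk (Ideal.span {ϖ ^ k})

open Classical in
/-- The valuation on the quotient, counted in units `1 / e`: it is the precision at `0`, and the
valuation of a lift elsewhere. -/
def fixedVal (x : Fixed A ϖ k) : ℕ∞ :=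
  if x = 0 then (k : ℕ∞) else emultiplicity ϖ (Quotient.out x)

open Classical in
/-- Division in the fixed point arithmetic model. -/
def fixedDiv (x y : Fixed A ϖ k) : Run (Fixed A ϖ k) :=
  if fixedVal x < fixedVal y then Run.error
  else if x = 0 then Run.ret 0
  else Run.choose {z | x = y * z}

/-- Truncation modulo `t ^ n`. -/
def truncT {R : Type*} [CommRing R] (n : ℕ) (f : R⟦X⟧) : R⟦X⟧ := (PowerSeries.trunc n f : R⟦X⟧)

/-- Division of the coefficients of `f` of degree less than `n` by the scalar `d`. -/
def divCoeffs (f : (Fixed A ϖ k)⟦X⟧) (d : Fixed A ϖ k) : ℕ → Run (Fixed A ϖ k)⟦X⟧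
  | 0 => pure 0
  | i + 1 => do
      let g ← divCoeffs f d i
      let c ← fixedDiv (PowerSeries.coeff i f) d
      pure (g + PowerSeries.monomial i c)

/-! ### The algorithms -/

/-- `LinDiffSolve(a, f, n)`, which solves `t (t - 4a) y' + (t - 2a) y = f` modulo `t ^ n`:
`y_0 = -f_0 / (2a)` and `y_i = (i y_{i-1} - f_i) / (2a (2i+1))`. For `i = 0` the term `i y_{i-1}`
is multiplied by `0`. -/
def linDiffSolve (a : Fixed A ϖ k) (f : (Fixed A ϖ k)⟦X⟧) : ℕ → Run (Fixed A ϖ k)⟦X⟧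
  | 0 => pure 0
  | i + 1 => do
      let y ← linDiffSolve a f i
      let c ← fixedDiv ((i : Fixed A ϖ k) * PowerSeries.coeff (i - 1) y - PowerSeries.coeff i f)
        (2 * a * (2 * (i : Fixed A ϖ k) + 1))
      pure (y + PowerSeries.monomial i c)

/-- The series `l t + t (t - 4a) q`. -/
def seriesOfQ {R : Type*} [CommRing R] (l a : R) (q : R⟦X⟧) : R⟦X⟧ :=
  PowerSeries.C l * PowerSeries.X +
    PowerSeries.X * (PowerSeries.X - PowerSeries.C (4 * a)) * q

/-- `W(t, q) = (l + (t - 4a) q) (l + t q) v²(l t + t (t - 4a) q)` modulo `t ^ n`, where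
`v2 = v²`. The last factor is a polynomial evaluated at a series without constant term. -/
def composeW {R : Type*} [CommRing R] (l a : R) (v2 q : R⟦X⟧) (n : ℕ) : R⟦X⟧ :=
  truncT n ((PowerSeries.C l + (PowerSeries.X - PowerSeries.C (4 * a)) * q) *
    (PowerSeries.C l + PowerSeries.X * q) *
    Polynomial.aeval (seriesOfQ l a q) (PowerSeries.trunc n v2))

/-- The data handed to the Newton iteration: `a`, `u`, `u²`, `u⁻³`, `b`, `v²`. -/
structure SolverData (R : Type*) where
  a : R
  u : R⟦X⟧
  u2 : R⟦X⟧
  uInv3 : R⟦X⟧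
  b : R
  v2 : R⟦X⟧

/-- `DiffSolve(a, u, u², u⁻³, b, v², n)`. It returns `q_n` modulo `t ^ n` and `(z')⁻²` modulo
`t ^ ⌈n/2⌉`. For `n = 0` there is nothing to compute. For `n = 1` the solution is known modulo
`t ^ 2`: it is `z1 t` with `z1 = b v(0)² / (a u(0)²)`, and `z1 = b / a - 4 a q_0`. Otherwise one
Newton step doubles the precision reached by the recursive call at `m = ⌈n/2⌉`. -/
def diffSolve (D : SolverData (Fixed A ϖ k)) (n : ℕ) :
    Run ((Fixed A ϖ k)⟦X⟧ × (Fixed A ϖ k)⟦X⟧) :=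
  if n = 0 then pure (0, 0)
  else if n = 1 then do
    let l ← fixedDiv D.b D.a
    -- the first coefficient of the solution
    let z1 ← fixedDiv (D.b * PowerSeries.constantCoeff D.v2)
      (D.a * PowerSeries.constantCoeff D.u2)
    let q0 ← fixedDiv (l - z1) (4 * D.a)
    let r0 ← fixedDiv 1 (z1 ^ 2)
    pure (PowerSeries.C q0, PowerSeries.C r0)
  else do
    let m := (n + 1) / 2
    let (qm, rm) ← diffSolve D m
    let l ← fixedDiv D.b D.a
    let zm := truncT (n + 1) (seriesOfQ l D.a qm)
    let dzm := PowerSeries.derivative (Fixed A ϖ k) zm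
    let wn := truncT n (dzm ^ 2)
    let sn := truncT n (composeW l D.a D.v2 qm n - D.u2 * wn)
    let rn := truncT m (rm * (2 - rm * wn))
    let hn ← divCoeffs sn 2 n
    let fn := truncT n (hn * rn * D.uInv3)
    let yn ← linDiffSolve D.a fn n
    pure (truncT n (qm + dzm * D.u * yn), rn)
termination_by n
decreasing_by omega

end FixedPoint

section Input

variable {A K : Type*} [CommRing A] [Field K] [Algebra A K]

/-- `U = t (t - 4a) u²` with `a` an invertible integer and `u` a series with integral coefficients
and invertible constant term. -/
def IsFactorization (U : K⟦X⟧) (a : A) (u : A⟦X⟧) : Prop :=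
  IsUnit a ∧ IsUnit (PowerSeries.constantCoeff u) ∧
    U = PowerSeries.X * (PowerSeries.X - PowerSeries.C (4 * algebraMap A K a)) *
      (PowerSeries.map (algebraMap A K) u) ^ 2

/-- The hypothesis made on both coefficients `U` and `V` of the equation. -/
def HasFactorization (A : Type*) [CommRing A] [Algebra A K] (U : K⟦X⟧) : Prop :=
  ∃ (a : A) (u : A⟦X⟧), IsFactorization U a u

/-- The precomputed data at the working precision: `u²` and `v²` modulo `t ^ (n-1)`, and
`u` and `u⁻³` modulo `t ^ ⌈(n-1)/2⌉`. -/
def solverData (ϖ : A) (k n : ℕ) (a : A) (u : A⟦X⟧) (b : A) (v : A⟦X⟧) :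
    SolverData (Fixed A ϖ k) where
  a := reduce ϖ k a
  u := truncT (n / 2) (PowerSeries.map (reduce ϖ k) u)
  u2 := truncT (n - 1) (PowerSeries.map (reduce ϖ k) (u ^ 2))
  uInv3 := truncT (n / 2) (PowerSeries.map (reduce ϖ k) (Ring.inverse (u ^ 3)))
  b := reduce ϖ k b
  v2 := truncT (n - 1) (PowerSeries.map (reduce ϖ k) (v ^ 2))

/-- The first step of `IsoSolve`: find factorizations of `U` and `V`. (Only the signs of `u` and
`v` are not determined by `U` and `V`; every choice is allowed.) -/
def precompute (ϖ : A) (k : ℕ) (U V : K⟦X⟧) (n : ℕ) : Run (SolverData (Fixed A ϖ k)) :=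
  Run.choose {D | ∃ (a : A) (u : A⟦X⟧) (b : A) (v : A⟦X⟧),
    IsFactorization U a u ∧ IsFactorization V b v ∧ D = solverData ϖ k n a u b v}

/-- `IsoSolve(U, V, n)` run in fixed point arithmetic, modulo `ϖ ^ k`. -/
def isoSolve (ϖ : A) (k : ℕ) (U V : K⟦X⟧) (n : ℕ) : Run (Fixed A ϖ k)⟦X⟧ := do
  let D ← precompute ϖ k U V n
  let (q, _) ← diffSolve D (n - 1)
  let l ← fixedDiv D.b D.a
  pure (truncT n (seriesOfQ l D.a q))

end Input

/-! ### The 2-adic setting -/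

/-- The ring of integers of an algebraic extension of `ℚ_[2]`: the integral closure of `ℤ_[2]`. -/
def ringOfInt (K : Type*) [Field K] [Algebra ℚ_[2] K] : Subring K :=
  letI : Algebra ℤ_[2] K := ((algebraMap ℚ_[2] K).comp (algebraMap ℤ_[2] ℚ_[2])).toAlgebra
  (integralClosure ℤ_[2] K).toSubring

/-- `z` is a nonzero solution, without constant term, of `U z'² = V ∘ z`. -/
def IsNonzeroSolution {K : Type*} [Field K] (U V z : K⟦X⟧) : Prop :=
  PowerSeries.constantCoeff z = 0 ∧ z ≠ 0 ∧
    U * (PowerSeries.derivative K z) ^ 2 = V.subst z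

end

/-! Write `z = l t + t (t - 4a) q` with `l = b / a`; the equation becomes `defect q = W(t, q) - u²
z'² = 0`. Following the errors from one Newton step to the next would lose digits at every step.
Instead, every series returned by `diffSolve` is shown to be an exact zero of the defect in the
quotient ring modulo `ϖ ^ k` (`diffSolve_ensures`), and the loss is measured only once, by a
stability theorem (`IsSolutionMod.mem_coeffIdeal_of_defect`): if `defect (q + p)` vanishes modulo `2
^ (ℓ + 2) * (8 * ν)`, then `p` vanishes modulo `8 * ν`.

Stability is separation of variables. The product `t (t - 4a) W(t, x)` depends only on `l t + t (t -
4a) x`, which gives a first order equation for `W` (`derivation_wVal`). Let `Y` be the integral of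
`W(t, x)^(-1/2)` for `x` from `q` to `q + p`, and let `z'` now denote the derivative of the series
attached to `q + p`. Then `linOp a Y` is `z' W(t, q + p)^(-1/2) - 1/u` (`linOp_sum_eq`), which is
small when `q + p` almost solves the equation; one factor `2` is lost in extracting the square root.
Inverting `linOp`, that is, solving `2a (2i+1) y_i = i y_{i-1} - f_i`, loses `1 + s(i)` digits in
degree `i`, where `s(i)` is the number of binary ones of `i`, since `i! / 2^i` has valuation
`-s(i)`; and `2 ^ s(i) ≤ i + 1`. Finally `Y` is `p` times a unit plus terms of higher order, which
are negligible because `p` is already controlled up to a factor `4` by induction on the degree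
(`two_mul_mem_coeffIdeal_of_defect`).

The same theorem explains why no division fails. A zero of the defect modulo `t ^ m` at the working
precision extends to one modulo `t ^ N` (`IsSolutionMod.exists_extension`), so an integral Newton
correction exists (`exists_newton_correction`). Hence `s_n` is even, and the right hand side given
to `linDiffSolve` is close to `linOp a` of an integral series, which keeps all its dividends
divisible by their divisors (`linDiffSolve_ensures`). -/

noncomputable section

/-! ### Congruences between power series -/

section CoeffIdeal

open PowerSeries

variable {R : Type*} [CommRing R]

/-- The series whose coefficients of degree less than `m` are multiples of `c`. -/
def coeffIdeal (c : R) (m : ℕ) : Ideal R⟦X⟧ where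
  carrier := {f | ∀ i < m, c ∣ coeff i f}
  add_mem' hf hg i hi := by simpa using dvd_add (hf i hi) (hg i hi)
  zero_mem' i _ := by simp
  smul_mem' g f hf i hi := by
    rw [smul_eq_mul, coeff_mul]
    refine Finset.dvd_sum fun p hp => Dvd.dvd.mul_left (hf _ ?_) _
    have := Finset.HasAntidiagonal.mem_antidiagonal.1 hp
    omega

theorem mem_coeffIdeal {c : R} {m : ℕ} {f : R⟦X⟧} :
    f ∈ coeffIdeal c m ↔ ∀ i < m, c ∣ coeff i f := Iff.rfl

theorem coeffIdeal_mono {c d : R} {m n : ℕ} (hcd : d ∣ c) (hmn : n ≤ m) {f : R⟦X⟧}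
    (hf : f ∈ coeffIdeal c m) : f ∈ coeffIdeal d n :=
  fun i hi => hcd.trans (hf i (hi.trans_le hmn))

/-- With `c = 0` the ideal expresses a purely `t`-adic congruence, so the results on `coeffIdeal`
also serve for divisibility by `X ^ m`. -/
theorem mem_coeffIdeal_zero {m : ℕ} {f : R⟦X⟧} : f ∈ coeffIdeal (0 : R) m ↔ X ^ m ∣ f := by
  simp [mem_coeffIdeal, X_pow_dvd_iff]

theorem coeffIdeal_of_X_pow_dvd {c : R} {m : ℕ} {f : R⟦X⟧} (h : X ^ m ∣ f) :
    f ∈ coeffIdeal c m :=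
  fun i hi => by rw [X_pow_dvd_iff.1 h i hi]; exact dvd_zero c

/-- A bare derivative loses one order in `t`; the factor `X`, always supplied by `t (t - 4a)`,
restores it. -/
theorem X_mul_derivative_mem_coeffIdeal {c : R} {m : ℕ} {f : R⟦X⟧} (hf : f ∈ coeffIdeal c m) :
    X * derivative R f ∈ coeffIdeal c m := by
  rintro (_ | i) hi
  · simp
  · rw [coeff_succ_X_mul, coeff_derivative]
    exact (hf _ hi).mul_right _

theorem mul_mem_coeffIdeal_of_C {c d : R} {m : ℕ} {f : R⟦X⟧} (hf : f ∈ coeffIdeal c m) :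
    C d * f ∈ coeffIdeal (d * c) m := by
  intro i hi
  rw [coeff_C_mul]
  exact mul_dvd_mul_left d (hf i hi)

theorem X_pow_dvd_map_mk_iff {c : R} {m : ℕ} {f : R⟦X⟧} :
    X ^ m ∣ PowerSeries.map (Ideal.Quotient.mk (Ideal.span {c})) f ↔ f ∈ coeffIdeal c m := by
  simp [mem_coeffIdeal, X_pow_dvd_iff, Ideal.Quotient.eq_zero_iff_mem, Ideal.mem_span_singleton]

theorem coeff_truncT (n i : ℕ) (f : R⟦X⟧) :
    coeff i (truncT n f) = if i < n then coeff i f else 0 := by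
  simp [truncT, Polynomial.coeff_coe, coeff_trunc]

theorem X_pow_dvd_truncT_sub (n : ℕ) (f : R⟦X⟧) : X ^ n ∣ truncT n f - f :=
  X_pow_dvd_iff.2 fun i hi => by simp [coeff_truncT, hi]

end CoeffIdeal

/-! ### The right hand side of the equation -/

section WVal

open Polynomial

variable {A B : Type*} [CommRing A] [CommRing B] [Algebra A B]

/-- `(l + (t - 4a) x) (l + t x) w(l t + t (t - 4a) x)`. -/
def wVal (w : A[X]) (t l a x : B) : B :=
  (l + (t - 4 * a) * x) * (l + t * x) * aeval (l * t + t * (t - 4 * a) * x) w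

/-- The derivative of `wVal` with respect to `x`. -/
def wDer (w : A[X]) (t l a x : B) : B :=
  (t - 4 * a) * (l + t * x) * aeval (l * t + t * (t - 4 * a) * x) w +
    t * (l + (t - 4 * a) * x) * aeval (l * t + t * (t - 4 * a) * x) w +
    t * (t - 4 * a) * (l + (t - 4 * a) * x) * (l + t * x) *
      aeval (l * t + t * (t - 4 * a) * x) (derivative w)

theorem exists_aeval_add (w : A[X]) (x y : B) :
    ∃ r, aeval (x + y) w = aeval x w + aeval x (derivative w) * y + r * y ^ 2 := by
  obtain ⟨r, hr⟩ := (w.map (algebraMap A B)).binomExpansion x y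
  refine ⟨r, ?_⟩
  simpa [Polynomial.derivative_map, eval_map_algebraMap] using hr

theorem wVal_add (w : A[X]) (t l a x y : B) :
    ∃ r, wVal w t l a (x + y) = wVal w t l a x + wDer w t l a x * y + r * y ^ 2 := by
  obtain ⟨r, hr⟩ := exists_aeval_add w (l * t + t * (t - 4 * a) * x) (t * (t - 4 * a) * y)
  have e : l * t + t * (t - 4 * a) * (x + y) =
      l * t + t * (t - 4 * a) * x + t * (t - 4 * a) * y := by ring
  unfold wVal wDer
  rw [e, hr]
  generalize aeval (l * t + t * (t - 4 * a) * x) w = w0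
  generalize aeval (l * t + t * (t - 4 * a) * x) (derivative w) = w1
  refine ⟨(t - 4 * a) * t * (w0 + w1 * (t * (t - 4 * a) * y) + r * (t * (t - 4 * a) * y) ^ 2) +
    ((t - 4 * a) * (l + t * x) + t * (l + (t - 4 * a) * x)) *
      (w1 * (t * (t - 4 * a)) + r * (t * (t - 4 * a)) ^ 2 * y) +
    (l + (t - 4 * a) * x) * (l + t * x) * (r * (t * (t - 4 * a)) ^ 2), ?_⟩
  ring

/-- With `ζ = l t + t (t - 4a) x` one has `t (t - 4a) W = ζ (ζ - 4 l a) w(ζ)`, a function `g(ζ)` of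
`ζ` alone, and `wDer` is `g'(ζ)`. The identity is `D (g(ζ)) = g'(ζ) D ζ`. An arbitrary derivation is
allowed so as to cover `d/dt` on series as well as both partial derivatives on polynomials over
series. -/
theorem derivation_wVal (D : Derivation A B B) (w : A[X]) {t l a : B} (x : B) (hl : D l = 0)
    (ha : D a = 0) :
    t * (t - 4 * a) * D (wVal w t l a x) + (2 * t - 4 * a) * D t * wVal w t l a x =
      (l * D t + (2 * t - 4 * a) * D t * x + t * (t - 4 * a) * D x) * wDer w t l a x := by
  have h4 : D 4 = 0 := mod_cast D.map_natCast 4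
  unfold wVal wDer
  simp only [D.leibniz, map_add, map_sub, D.map_aeval, hl, ha, h4, smul_eq_mul]
  ring

theorem map_wVal {A' B' : Type*} [CommRing A'] [CommRing B'] [Algebra A' B'] (φ : A →+* A')
    (ψ : B →+* B') (h : (algebraMap A' B').comp φ = ψ.comp (algebraMap A B)) (w : A[X])
    (t l a x : B) :
    ψ (wVal w t l a x) = wVal (w.map φ) (ψ t) (ψ l) (ψ a) (ψ x) := by
  simp [wVal, Polynomial.map_aeval_eq_aeval_map h, map_ofNat ψ 4]

end WVal

/-! ### The equation satisfied by `q` and its linearization -/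

section Residual

open PowerSeries

variable {R : Type*} [CommRing R]

/-- The linear operator `t (t - 4a) y' + (t - 2a) y`. -/
def linOp (a : R) (y : R⟦X⟧) : R⟦X⟧ :=
  X * (X - 4 * C a) * derivative R y + (X - 2 * C a) * y

theorem seriesOfQ_eq (l a : R) (x : R⟦X⟧) :
    seriesOfQ l a x = C l * X + X * (X - 4 * C a) * x := by
  rw [seriesOfQ, map_mul, map_ofNat C 4]

/-- The derivative of `l t + t (t - 4a) x`. -/
def dSeries (l a : R) (x : R⟦X⟧) : R⟦X⟧ := derivative R (seriesOfQ l a x)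

theorem derivative_four : derivative R (4 : R⟦X⟧) = 0 :=
  mod_cast (derivative R).map_natCast 4

theorem dSeries_eq (l a : R) (x : R⟦X⟧) :
    dSeries l a x = C l + (2 * X - 4 * C a) * x + X * (X - 4 * C a) * derivative R x := by
  rw [dSeries, seriesOfQ_eq]
  simp only [map_add, Derivation.leibniz, derivative_C, derivative_X, map_sub, derivative_four,
    smul_eq_mul]
  ring

theorem dSeries_add (l a : R) (x y : R⟦X⟧) :
    dSeries l a (x + y) = dSeries l a x + dSeries 0 a y := by
  simp only [dSeries_eq, map_add, map_zero]; ring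

theorem constantCoeff_dSeries (l a : R) (x : R⟦X⟧) :
    constantCoeff (dSeries l a x) = l - 4 * a * constantCoeff x := by
  simp [dSeries_eq, map_ofNat (constantCoeff (R := R)) 4]; ring

theorem dSeries_mem_coeffIdeal {a c : R} {m : ℕ} {x : R⟦X⟧} (hx : x ∈ coeffIdeal c m) :
    dSeries 0 a x ∈ coeffIdeal c m := by
  rw [dSeries_eq, map_zero, zero_add]
  refine add_mem (Ideal.mul_mem_left _ _ hx) ?_
  rw [mul_comm X, mul_assoc]
  exact Ideal.mul_mem_left _ _ (X_mul_derivative_mem_coeffIdeal hx)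

/-- The defect of `x` as a solution of `u² z'² = W(t, x)`, where `z = l t + t (t - 4a) x`. -/
def defect (l a : R) (u : R⟦X⟧) (w : Polynomial R) (x : R⟦X⟧) : R⟦X⟧ :=
  wVal w X (C l) (C a) x - u ^ 2 * dSeries l a x ^ 2

theorem defect_add_sub_mem {l a c : R} {u : R⟦X⟧} {w : Polynomial R} {m : ℕ} (x : R⟦X⟧)
    {y : R⟦X⟧} (hy : y ∈ coeffIdeal c m) :
    defect l a u w (x + y) - defect l a u w x ∈ coeffIdeal c m := by
  obtain ⟨r, hr⟩ := wVal_add w X (C l) (C a) x y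
  have e : defect l a u w (x + y) - defect l a u w x =
      (wDer w X (C l) (C a) x + r * y) * y -
        u ^ 2 * (2 * dSeries l a x + dSeries 0 a y) * dSeries 0 a y := by
    simp only [defect, hr, dSeries_add]; ring
  rw [e]
  exact sub_mem (Ideal.mul_mem_left _ _ hy) (Ideal.mul_mem_left _ _ (dSeries_mem_coeffIdeal hy))

theorem defect_congr {l a c : R} {u : R⟦X⟧} {w : Polynomial R} {m : ℕ} {x y : R⟦X⟧}
    (h : y - x ∈ coeffIdeal c m) :
    defect l a u w y - defect l a u w x ∈ coeffIdeal c m := by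
  simpa using defect_add_sub_mem (l := l) (a := a) (u := u) (w := w) x h

theorem defect_mem_congr {l a c : R} {u : R⟦X⟧} {w : Polynomial R} {m : ℕ} {x y : R⟦X⟧}
    (h : y - x ∈ coeffIdeal c m) (hx : defect l a u w x ∈ coeffIdeal c m) :
    defect l a u w y ∈ coeffIdeal c m := by
  simpa using add_mem (defect_congr (l := l) (a := a) (u := u) (w := w) h) hx

theorem derivative_wVal (l a : R) (w : Polynomial R) (x : R⟦X⟧) :
    X * (X - 4 * C a) * derivative R (wVal w X (C l) (C a) x) +
      (2 * X - 4 * C a) * wVal w X (C l) (C a) x =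
      dSeries l a x * wDer w X (C l) (C a) x := by
  have h := derivation_wVal (derivative R) w (t := X) (l := C l) (a := C a) x
    (derivative_C (R := R)) (derivative_C (R := R))
  rw [derivative_X] at h
  rw [dSeries_eq]
  linear_combination h

/-- The effect of a Newton step on the defect. -/
theorem newton_defect (l a : R) (u : R⟦X⟧) (w : Polynomial R) {m : ℕ} {x y : R⟦X⟧}
    (hx : X ^ m ∣ defect l a u w x) (hy : X ^ m ∣ y) :
    X ^ (2 * m) ∣ defect l a u w (x + dSeries l a x * u * y) -
      (defect l a u w x - 2 * u ^ 3 * dSeries l a x ^ 2 * linOp a y) := by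
  set s := defect l a u w x with hs
  set z := dSeries l a x with hz
  obtain ⟨r, hr⟩ := wVal_add w X (C l) (C a) x (z * u * y)
  have hW : wVal w X (C l) (C a) x = s + u ^ 2 * z ^ 2 := by rw [hs, defect, ← hz]; ring
  -- Since `W = s + u² z²`, this relation eliminates `wDer` from the first variation of the defect.
  -- What remains besides `linOp a y` is `y` times `s` or `X s'`, hence of order `2m`.
  have hD := derivative_wVal l a w x
  rw [hW, ← hz] at hD
  have hdD : derivative R (s + u ^ 2 * z ^ 2) = derivative R s +
      2 * u * z ^ 2 * derivative R u + 2 * u ^ 2 * z * derivative R z := by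
    simp only [map_add, Derivation.leibniz, Derivation.leibniz_pow, smul_eq_mul, nsmul_eq_mul]
    push_cast; ring
  rw [hdD] at hD
  have hd0 : dSeries 0 a (z * u * y) = (2 * X - 4 * C a) * (z * u * y) +
      X * (X - 4 * C a) * (derivative R z * u * y + z * derivative R u * y +
        z * u * derivative R y) := by
    rw [dSeries_eq, map_zero]
    simp only [Derivation.leibniz, smul_eq_mul]; ring
  have e : defect l a u w (x + z * u * y) -
      (s - 2 * u ^ 3 * z ^ 2 * linOp a y) =
      u * y * ((X - 4 * C a) * (X * derivative R s) + (2 * X - 4 * C a) * s) +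
        r * (z * u) ^ 2 * (y * y) - u ^ 2 * (dSeries 0 a (z * u * y) * dSeries 0 a (z * u * y)) := by
    have : defect l a u w (x + z * u * y) = s + wDer w X (C l) (C a) x * (z * u * y) +
        r * (z * u * y) ^ 2 - u ^ 2 * (2 * z * dSeries 0 a (z * u * y)) -
          u ^ 2 * (dSeries 0 a (z * u * y) * dSeries 0 a (z * u * y)) := by
      rw [defect, hr, hW, dSeries_add, ← hz]; ring
    rw [this]
    generalize hE : dSeries 0 a (z * u * y) * dSeries 0 a (z * u * y) = E
    rw [hd0, linOp]
    linear_combination (-u * y) * hD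
  rw [e, two_mul, pow_add]
  have hδ : X ^ m ∣ dSeries 0 a (z * u * y) :=
    mem_coeffIdeal_zero.1 (dSeries_mem_coeffIdeal (mem_coeffIdeal_zero.2 (hy.mul_left _)))
  have hs' : X ^ m ∣ X * derivative R s :=
    mem_coeffIdeal_zero.1 (X_mul_derivative_mem_coeffIdeal (mem_coeffIdeal_zero.2 hx))
  refine dvd_sub (dvd_add ?_ ((mul_dvd_mul hy hy).mul_left _)) ((mul_dvd_mul hδ hδ).mul_left _)
  rw [mul_comm u y, mul_assoc]
  exact mul_dvd_mul hy ((dvd_add (hs'.mul_left _) (hx.mul_left _)).mul_left _)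

theorem map_derivative {S : Type*} [CommRing S] (φ : R →+* S) (f : R⟦X⟧) :
    PowerSeries.map φ (derivative R f) = derivative S (PowerSeries.map φ f) := by
  ext i; simp [coeff_derivative]

theorem map_seriesOfQ {S : Type*} [CommRing S] (φ : R →+* S) (l a : R) (x : R⟦X⟧) :
    PowerSeries.map φ (seriesOfQ l a x) = seriesOfQ (φ l) (φ a) (PowerSeries.map φ x) := by
  simp [seriesOfQ_eq, map_ofNat (PowerSeries.map φ) 4]

theorem map_dSeries {S : Type*} [CommRing S] (φ : R →+* S) (l a : R) (x : R⟦X⟧) :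
    PowerSeries.map φ (dSeries l a x) = dSeries (φ l) (φ a) (PowerSeries.map φ x) := by
  rw [dSeries, map_derivative, map_seriesOfQ, dSeries]

theorem map_linOp {S : Type*} [CommRing S] (φ : R →+* S) (a : R) (x : R⟦X⟧) :
    PowerSeries.map φ (linOp a x) = linOp (φ a) (PowerSeries.map φ x) := by
  simp [linOp, map_derivative, map_ofNat (PowerSeries.map φ) 4,
    map_ofNat (PowerSeries.map φ) 2]

theorem map_defect {S : Type*} [CommRing S] (φ : R →+* S) (l a : R) (u : R⟦X⟧)
    (w : Polynomial R) (x : R⟦X⟧) :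
    PowerSeries.map φ (defect l a u w x) =
      defect (φ l) (φ a) (PowerSeries.map φ u) (w.map φ) (PowerSeries.map φ x) := by
  have h : (algebraMap S S⟦X⟧).comp φ = (PowerSeries.map φ).comp (algebraMap R R⟦X⟧) := by
    ext r : 1
    change C (φ r) = PowerSeries.map φ (C r)
    simp
  simp [defect, map_wVal φ (PowerSeries.map φ) h, map_dSeries]

end Residual

/-! ### The inverse square root of the right hand side, expanded at a solution -/

section InvSqrt

open Polynomial

variable {K : Type*} [Field K]

/-- The derivation of `K⟦t⟧[X]` which is `d / dt` on coefficients. -/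
def coeffDerivative (K : Type*) [Field K] : Derivation K K⟦X⟧[X] K⟦X⟧[X] :=
  (PolynomialModule.equivPolynomialSelf.toLinearMap).compDer
    (PowerSeries.derivative K).mapCoeffs

theorem coeff_coeffDerivative (p : K⟦X⟧[X]) (i : ℕ) :
    (coeffDerivative K p).coeff i = PowerSeries.derivative K (p.coeff i) := rfl

theorem coeffDerivative_C (f : K⟦X⟧) :
    coeffDerivative K (C f) = C (PowerSeries.derivative K f) := by
  ext1 i
  rw [coeff_coeffDerivative, coeff_C, coeff_C]
  split_ifs <;> simp

theorem coeffDerivative_X : coeffDerivative K (X : K⟦X⟧[X]) = 0 := by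
  ext1 i
  rw [coeff_coeffDerivative, coeff_X]
  split_ifs <;> simp

/-- The polynomial with coefficients `f k / k!` for `k < N`. -/
def egfPoly (f : ℕ → K⟦X⟧) (N : ℕ) : K⟦X⟧[X] :=
  ∑ k ∈ Finset.range N, C (PowerSeries.C ((k.factorial : K)⁻¹) * f k) * X ^ k

theorem coeff_egfPoly (f : ℕ → K⟦X⟧) (N k : ℕ) :
    (egfPoly f N).coeff k = if k < N then PowerSeries.C ((k.factorial : K)⁻¹) * f k else 0 := by
  simp only [egfPoly, finsetSum_coeff, coeff_C_mul_X_pow]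
  simp

/-- The polynomial `W(t, q + X)`. -/
def shiftedW (l a : K) (w : K[X]) (q : K⟦X⟧) : K⟦X⟧[X] :=
  wVal w (C PowerSeries.X) (C (PowerSeries.C l)) (C (PowerSeries.C a)) (C q + X)

/-- Two instances of `derivation_wVal` are combined: differentiation of the coefficients in `t`
gives the equation, and differentiation in the variable of the polynomial identifies `wDer`, after
cancelling `t (t - 4a)`. -/
theorem shiftedW_pde (l a : K) (w : K[X]) (q : K⟦X⟧) :
    C (PowerSeries.X * (PowerSeries.X - 4 * PowerSeries.C a)) * coeffDerivative K (shiftedW l a w q)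
      + C (2 * PowerSeries.X - 4 * PowerSeries.C a) * shiftedW l a w q =
      (C (dSeries l a q) + C (2 * PowerSeries.X - 4 * PowerSeries.C a) * X) *
        derivative (shiftedW l a w q) := by
  have h1 := derivation_wVal (coeffDerivative K) w (t := C PowerSeries.X)
    (l := C (PowerSeries.C l)) (a := C (PowerSeries.C a)) (C q + X)
    (by rw [coeffDerivative_C, PowerSeries.derivative_C, map_zero])
    (by rw [coeffDerivative_C, PowerSeries.derivative_C, map_zero])
  have h2 := derivation_wVal ((derivative' (R := K⟦X⟧)).restrictScalars K) w
    (t := C PowerSeries.X) (l := C (PowerSeries.C l)) (a := C (PowerSeries.C a)) (C q + X)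
    (by simp) (by simp)
  simp only [Derivation.restrictScalars_apply, derivative'_apply, derivative_C, derivative_X,
    map_add, mul_zero, zero_mul, zero_add, add_zero, mul_one] at h2
  have hne : (C PowerSeries.X * (C PowerSeries.X - 4 * C (PowerSeries.C a)) : K⟦X⟧[X]) ≠ 0 := by
    have h4 : (4 : K⟦X⟧[X]) = C 4 := (map_ofNat C 4).symm
    rw [h4, ← C_mul, ← C_sub, ← C_mul, Ne, C_eq_zero, mul_eq_zero, not_or]
    refine ⟨PowerSeries.X_ne_zero, fun h => ?_⟩
    have := congrArg (PowerSeries.coeff 1) h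
    rw [← map_ofNat PowerSeries.C 4, ← map_mul] at this
    simp at this
  have h3 : derivative (shiftedW l a w q) = _ := mul_left_cancel₀ hne h2
  rw [h3, dSeries_eq]
  rw [map_add, coeffDerivative_C, coeffDerivative_C, coeffDerivative_X,
    PowerSeries.derivative_X] at h1
  simp only [map_add, map_mul, map_sub, map_ofNat, map_one, mul_one, add_zero] at h1 ⊢
  rw [shiftedW]
  linear_combination h1

/-- The recurrence on `f` is the equation satisfied by `W ^ (-1/2)`, read on Taylor coefficients.
Truncation at `N` spoils only the coefficients of degree at least `N - 1`. -/
theorem egfPoly_pde {a : K} {z : K⟦X⟧} [CharZero K] {f : ℕ → K⟦X⟧}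
    (hf : ∀ k : ℕ, z * f (k + 1) = PowerSeries.X * (PowerSeries.X - 4 * PowerSeries.C a) *
      PowerSeries.derivative K (f k) -
        (2 * (k : K⟦X⟧) + 1) * (PowerSeries.X - 2 * PowerSeries.C a) * f k) (N k : ℕ) (hk : k + 1 < N) :
    (C (PowerSeries.X * (PowerSeries.X - 4 * PowerSeries.C a)) * coeffDerivative K (egfPoly f N)
      - (C z + C (2 * PowerSeries.X - 4 * PowerSeries.C a) * X) * derivative (egfPoly f N)
      - C (PowerSeries.X - 2 * PowerSeries.C a) * egfPoly f N).coeff k = 0 := by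
  have hX : (X * derivative (egfPoly f N)).coeff k = (egfPoly f N).coeff k * k := by
    cases k with
    | zero => simp
    | succ k => rw [coeff_X_mul, coeff_derivative]; push_cast; rfl
  rw [add_mul, mul_assoc (C (2 * PowerSeries.X - 4 * PowerSeries.C a))]
  simp only [coeff_sub, coeff_add, coeff_C_mul, hX, coeff_coeffDerivative, coeff_derivative]
  rw [coeff_egfPoly, coeff_egfPoly, if_pos hk, if_pos (by omega)]
  have h1 : PowerSeries.C (((k + 1).factorial : K)⁻¹) * ((k : K⟦X⟧) + 1) =
      PowerSeries.C ((k.factorial : K)⁻¹) := by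
    rw [show (k : K⟦X⟧) + 1 = PowerSeries.C ((k : K) + 1) by simp, ← map_mul, Nat.factorial_succ]
    congr 1
    have : (k : K) + 1 ≠ 0 := k.cast_add_one_ne_zero
    have : (k.factorial : K) ≠ 0 := mod_cast k.factorial_ne_zero
    push_cast
    field_simp
  have h2 : z * (PowerSeries.C (((k + 1).factorial : K)⁻¹) * f (k + 1) * ((k : K⟦X⟧) + 1)) =
      PowerSeries.C ((k.factorial : K)⁻¹) * (z * f (k + 1)) := by rw [← h1]; ring
  rw [h2, hf, Derivation.leibniz, PowerSeries.derivative_C]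
  simp only [smul_eq_mul]
  ring

/-- The square of the expansion `∑ f k X^k / k!` is an inverse of `W(t, q + X)`. -/
theorem X_pow_dvd_coeff_egfPoly_sq_mul [CharZero K] {l a : K} {w : K[X]} {q : K⟦X⟧}
    {f : ℕ → K⟦X⟧} {n N : ℕ} (hz : IsUnit (dSeries l a q))
    (hf : ∀ k : ℕ, dSeries l a q * f (k + 1) =
      PowerSeries.X * (PowerSeries.X - 4 * PowerSeries.C a) * PowerSeries.derivative K (f k) -
        (2 * (k : K⟦X⟧) + 1) * (PowerSeries.X - 2 * PowerSeries.C a) * f k)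
    (h0 : PowerSeries.X ^ n ∣
      f 0 ^ 2 * wVal w PowerSeries.X (PowerSeries.C l) (PowerSeries.C a) q - 1) (k : ℕ)
    (hk : k < N) :
    PowerSeries.X ^ n ∣ (egfPoly f N ^ 2 * shiftedW l a w q - 1).coeff k := by
  set T : K⟦X⟧ := PowerSeries.X * (PowerSeries.X - 4 * PowerSeries.C a) with hT
  set T' : K⟦X⟧ := 2 * PowerSeries.X - 4 * PowerSeries.C a with hT'
  set z := dSeries l a q with hzdef
  set Φ := egfPoly f N with hΦ
  set Ω := shiftedW l a w q with hΩ
  set S : K⟦X⟧ := PowerSeries.X - 2 * PowerSeries.C a with hS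
  have hTS : C T' = 2 * C S := by
    rw [hT', hS, ← map_ofNat C 2, ← C_mul]; congr 1; ring
  obtain ⟨E, hE⟩ : ∃ E, E = C T * coeffDerivative K Φ - (C z + C T' * X) * derivative Φ
      - C S * Φ := ⟨_, rfl⟩
  have hE0 : ∀ k, k + 1 < N → E.coeff k = 0 := fun k hk => by
    rw [hE]; exact egfPoly_pde hf N k hk
  have hΩ1 : C T * coeffDerivative K Ω + C T' * Ω = (C z + C T' * X) * derivative Ω :=
    shiftedW_pde l a w q
  set P := Φ ^ 2 * Ω with hP
  -- In `P = Φ² Ω` the zeroth order terms cancel, because `T' = 2 S`. The constant `1` solves the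
  -- resulting equation, whose coefficient of degree `k` determines `P_{k+1}` from `P_k` as `z` is a
  -- unit; so `P_0 ≡ 1` propagates.
  have hpde : C T * coeffDerivative K P = (C z + C T' * X) * derivative P + 2 * Φ * Ω * E := by
    rw [hP, pow_two]
    simp only [Derivation.leibniz, derivative_mul, smul_eq_mul]
    linear_combination Φ ^ 2 * hΩ1 - 2 * Φ * Ω * hE - Φ ^ 2 * Ω * hTS
  have hstep : ∀ k, k + 1 < N → T * PowerSeries.derivative K (P.coeff k) =
      z * (P.coeff (k + 1) * ((k : K⟦X⟧) + 1)) + T' * (P.coeff k * (k : K⟦X⟧)) := by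
    intro k hk
    have h := congrArg (fun p => coeff p k) hpde
    have hX : (X * derivative P).coeff k = P.coeff k * k := by
      cases k with
      | zero => simp
      | succ k => rw [coeff_X_mul, coeff_derivative]; push_cast; rfl
    have hlast : (2 * Φ * Ω * E).coeff k = 0 := by
      rw [coeff_mul]
      refine Finset.sum_eq_zero fun p hp => ?_
      have := Finset.HasAntidiagonal.mem_antidiagonal.1 hp
      rw [hE0 p.2 (by omega), mul_zero]
    simp only [add_mul, mul_assoc (C T')] at h
    simpa only [coeff_add, coeff_C_mul, coeff_coeffDerivative, coeff_derivative, hX, hlast,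
      add_zero] using h
  induction k with
  | zero =>
    have hΩ0 : Ω.coeff 0 = wVal w PowerSeries.X (PowerSeries.C l) (PowerSeries.C a) q := by
      rw [coeff_zero_eq_eval_zero, ← coe_evalRingHom, hΩ, shiftedW,
        map_wVal (RingHom.id K) (evalRingHom (0 : K⟦X⟧))
          (by ext x : 1; simp [Polynomial.algebraMap_apply])]
      simp
    have hΦ0 : Φ.coeff 0 = f 0 := by rw [hΦ, coeff_egfPoly, if_pos hk]; simp
    rw [coeff_sub, hP, pow_two, mul_coeff_zero, mul_coeff_zero, hΩ0, hΦ0, coeff_one_zero]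
    simpa [pow_two] using h0
  | succ k ih =>
    have h := hstep k hk
    have ih := ih (by omega)
    have h1 : PowerSeries.X ^ n ∣ T * PowerSeries.derivative K (P.coeff k) := by
      have hd : PowerSeries.derivative K (P.coeff k) =
          PowerSeries.derivative K ((P - 1).coeff k) := by
        rw [coeff_sub, map_sub, coeff_one]; split_ifs <;> simp
      rw [hd, hT, mul_comm PowerSeries.X, mul_assoc]
      exact (mem_coeffIdeal_zero.1 (X_mul_derivative_mem_coeffIdeal
        (mem_coeffIdeal_zero.2 ih))).mul_left _
    have h2 : PowerSeries.X ^ n ∣ T' * (P.coeff k * (k : K⟦X⟧)) := by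
      rcases k with _ | k
      · simp
      · rw [coeff_sub, coeff_one, if_neg (by omega), sub_zero] at ih
        exact (ih.mul_right _).mul_left _
    rw [coeff_sub, coeff_one, if_neg (by omega), sub_zero]
    have h3 : PowerSeries.X ^ n ∣ z * (P.coeff (k + 1) * ((k : K⟦X⟧) + 1)) := by
      rw [show z * (P.coeff (k + 1) * ((k : K⟦X⟧) + 1)) = T * PowerSeries.derivative K (P.coeff k) -
        T' * (P.coeff k * (k : K⟦X⟧)) by rw [h]; ring]
      exact dvd_sub h1 h2
    have hu : IsUnit ((k : K⟦X⟧) + 1) := by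
      rw [show (k : K⟦X⟧) + 1 = PowerSeries.C ((k : K) + 1) by simp]
      exact (IsUnit.mk0 _ k.cast_add_one_ne_zero).map _
    exact (hu.dvd_mul_right).1 ((hz.dvd_mul_left).1 h3)

end InvSqrt

/-! ### Integrality of exponential generating polynomials -/

section Integrality

variable {A K : Type*} [CommRing A] [Field K] [Algebra A K]

/-- The polynomials over `K⟦t⟧` which become integral when the coefficient of degree `k` is
multiplied by `k!`. -/
def IsEgfIntegral (A : Type*) {K : Type*} [CommRing A] [Field K] [Algebra A K]
    (P : Polynomial K⟦X⟧) : Prop :=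
  ∀ k : ℕ, ∃ e : A⟦X⟧, PowerSeries.map (algebraMap A K) e = (k.factorial : K⟦X⟧) * P.coeff k

theorem IsEgfIntegral.mul {P Q : Polynomial K⟦X⟧} (hP : IsEgfIntegral A P)
    (hQ : IsEgfIntegral A Q) : IsEgfIntegral A (P * Q) := by
  choose e he using hP
  choose g hg using hQ
  intro k
  refine ⟨∑ x ∈ Finset.HasAntidiagonal.antidiagonal k, (k.choose x.1 : A⟦X⟧) * (e x.1 * g x.2), ?_⟩
  rw [Polynomial.coeff_mul, map_sum, Finset.mul_sum]
  refine Finset.sum_congr rfl fun x hx => ?_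
  have hx := Finset.HasAntidiagonal.mem_antidiagonal.1 hx
  have hf : k.choose x.1 * x.1.factorial * x.2.factorial = k.factorial := by
    rw [← hx, ← Nat.add_choose_mul_factorial_mul_factorial x.1 x.2, Nat.choose_symm_add]
  rw [map_mul, map_mul, he, hg, map_natCast, ← hf]
  push_cast
  ring

theorem IsEgfIntegral.sub {P Q : Polynomial K⟦X⟧} (hP : IsEgfIntegral A P)
    (hQ : IsEgfIntegral A Q) : IsEgfIntegral A (P - Q) := by
  intro k
  obtain ⟨e, he⟩ := hP k
  obtain ⟨g, hg⟩ := hQ k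
  exact ⟨e - g, by rw [map_sub, he, hg, Polynomial.coeff_sub, mul_sub]⟩

theorem isEgfIntegral_map (P : Polynomial A⟦X⟧) :
    IsEgfIntegral A (P.map (PowerSeries.map (algebraMap A K))) :=
  fun k => ⟨(k.factorial : A⟦X⟧) * P.coeff k, by
    rw [map_mul, map_natCast, Polynomial.coeff_map]⟩

theorem isEgfIntegral_egfPoly [CharZero K] (f : ℕ → A⟦X⟧) (N : ℕ) :
    IsEgfIntegral A (egfPoly (fun k => PowerSeries.map (algebraMap A K) (f k)) N) := by
  intro k
  rw [coeff_egfPoly]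
  split_ifs
  · refine ⟨f k, ?_⟩
    have h : (k.factorial : K) ≠ 0 := mod_cast k.factorial_ne_zero
    rw [← mul_assoc, ← map_natCast (PowerSeries.C (R := K)), ← map_mul, mul_inv_cancel₀ h, map_one,
      one_mul]
  · exact ⟨0, by simp⟩

theorem isEgfIntegral_shiftedW (l a : A) (w : Polynomial A) (q : A⟦X⟧) :
    IsEgfIntegral A (shiftedW (algebraMap A K l) (algebraMap A K a) (w.map (algebraMap A K))
      (PowerSeries.map (algebraMap A K) q)) := by
  have h : ((algebraMap K (Polynomial K⟦X⟧)).comp (algebraMap A K)) =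
      (Polynomial.mapRingHom (PowerSeries.map (algebraMap A K))).comp
        (algebraMap A (Polynomial A⟦X⟧)) := by
    ext x : 1
    simp only [RingHom.comp_apply, Polynomial.algebraMap_apply, Polynomial.coe_mapRingHom,
      Polynomial.map_C, PowerSeries.algebraMap_apply]
    congr 1
    simp
  have := map_wVal (algebraMap A K) (Polynomial.mapRingHom (PowerSeries.map (algebraMap A K))) h w
    (Polynomial.C PowerSeries.X) (Polynomial.C (PowerSeries.C l)) (Polynomial.C (PowerSeries.C a))
    (Polynomial.C q + Polynomial.X)
  simp only [Polynomial.coe_mapRingHom, Polynomial.map_C, Polynomial.map_add, Polynomial.map_X,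
    PowerSeries.map_X, PowerSeries.map_C] at this
  rw [shiftedW, ← this]
  exact isEgfIntegral_map _

end Integrality

/-! ### Evaluation of the inverse square root near the solution -/

section SqMul

open PowerSeries

variable {A : Type*} [CommRing A] [IsDomain A] [CharZero A]

/-- The expansion of the inverse square root of `W(t, ·)` at the solution `q`, evaluated at
`q + p`; `γ k` is `p ^ k / k!`. -/
theorem sq_mul_wVal_sub_one_mem {l a : A} {w : Polynomial A} {q p : A⟦X⟧} {f γ : ℕ → A⟦X⟧}
    {n N m : ℕ} {c : A} (hz : IsUnit (dSeries l a q))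
    (hf : ∀ k : ℕ, dSeries l a q * f (k + 1) = X * (X - 4 * C a) * derivative A (f k) -
        (2 * (k : A⟦X⟧) + 1) * (X - 2 * C a) * f k)
    (h0 : X ^ n ∣ f 0 ^ 2 * wVal w X (C l) (C a) q - 1)
    (hγ : ∀ k : ℕ, (k.factorial : A⟦X⟧) * γ k = p ^ k) (hmn : m ≤ n)
    (hc : ∀ k, N ≤ k → γ k ∈ coeffIdeal c m) :
    (∑ k ∈ Finset.range N, f k * γ k) ^ 2 * wVal w X (C l) (C a) (q + p) - 1 ∈
      coeffIdeal c m := by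
  let K := FractionRing A
  have : CharZero K := IsFractionRing.charZero A
  set φ := algebraMap A K with hφ
  set ι := PowerSeries.map φ with hι
  have hφi : Function.Injective φ := IsFractionRing.injective A K
  have hιi : Function.Injective ι := PowerSeries.map_injective φ hφi
  have hcomp : (algebraMap K K⟦X⟧).comp φ = ι.comp (algebraMap A A⟦X⟧) := by
    ext x : 1
    simp only [RingHom.comp_apply, PowerSeries.algebraMap_apply, hι]
    simp
  set Q : Polynomial K⟦X⟧ := egfPoly (fun k => ι (f k)) N ^ 2 *
    shiftedW (φ l) (φ a) (w.map φ) (ι q) - 1 with hQ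
  have hQint : IsEgfIntegral A Q := by
    rw [hQ, pow_two]
    refine (((isEgfIntegral_egfPoly f N).mul (isEgfIntegral_egfPoly f N)).mul
      (isEgfIntegral_shiftedW l a w q)).sub ?_
    simpa using isEgfIntegral_map (K := K) (1 : Polynomial A⟦X⟧)
  choose e he using hQint
  have hQ0 : ∀ k < N, X ^ n ∣ Q.coeff k := by
    refine X_pow_dvd_coeff_egfPoly_sq_mul ?_ ?_ ?_
    · rw [← map_dSeries]; exact hz.map _
    · intro k
      have := congrArg ι (hf k)
      simpa only [map_mul, map_sub, map_add, map_one, map_ofNat, map_natCast, map_X, map_C, hι,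
        map_dSeries, map_derivative] using this
    · have := map_dvd ι h0
      rw [map_sub, map_mul, map_pow, map_pow, map_one, map_wVal φ ι hcomp] at this
      simpa only [map_X, map_C, hι] using this
  -- Two reasons for smallness: below `N` the coefficients of `Q` vanish modulo `t ^ n`; from `N`
  -- on, the divided powers `γ k` are multiples of `c`.
  have heγ : ∀ k, e k * γ k ∈ coeffIdeal c m := by
    intro k
    rcases lt_or_ge k N with hk | hk
    · refine coeffIdeal_of_X_pow_dvd (((pow_dvd_pow X hmn).trans ?_).mul_right _)
      have h := (hQ0 k hk).mul_left (k.factorial : K⟦X⟧)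
      rw [← he] at h
      rw [X_pow_dvd_iff] at h ⊢
      intro i hi
      have := h i hi
      rw [coeff_map, ← map_zero (algebraMap A K)] at this
      exact hφi this
    · exact Ideal.mul_mem_left _ _ (hc k hk)
  have heq : (∑ k ∈ Finset.range N, f k * γ k) ^ 2 * wVal w X (C l) (C a) (q + p) - 1 =
      ∑ k ∈ Finset.range (Q.natDegree + 1), e k * γ k := by
    apply hιi
    have h1 : (egfPoly (fun k => ι (f k)) N).eval (ι p) =
        ι (∑ k ∈ Finset.range N, f k * γ k) := by
      rw [egfPoly, Polynomial.eval_finsetSum, map_sum]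
      refine Finset.sum_congr rfl fun k _ => ?_
      have h : (k.factorial : K) ≠ 0 := mod_cast k.factorial_ne_zero
      have h' : C ((k.factorial : K)⁻¹) * (k.factorial : K⟦X⟧) = 1 := by
        rw [← map_natCast (C (R := K)), ← map_mul, inv_mul_cancel₀ h, map_one]
      simp only [Polynomial.eval_mul, Polynomial.eval_C, Polynomial.eval_pow, Polynomial.eval_X]
      rw [← map_pow, ← hγ, map_mul, map_mul, map_natCast]
      linear_combination ι (f k) * ι (γ k) * h'
    have h2 : (shiftedW (φ l) (φ a) (w.map φ) (ι q)).eval (ι p) =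
        ι (wVal w X (C l) (C a) (q + p)) := by
      rw [map_wVal φ ι hcomp, shiftedW, ← Polynomial.coe_evalRingHom,
        map_wVal (RingHom.id K) (Polynomial.evalRingHom (ι p))
          (by ext x : 1; simp [Polynomial.algebraMap_apply])]
      simp [hι]
    have h3 : Q.eval (ι p) = ∑ k ∈ Finset.range (Q.natDegree + 1), ι (e k * γ k) := by
      rw [Polynomial.eval_eq_sum_range]
      refine Finset.sum_congr rfl fun k _ => ?_
      rw [map_mul, he, ← map_pow, ← hγ, map_mul, map_natCast]
      ring
    rw [map_sum, ← h3, hQ, map_sub, map_mul, map_pow, map_one, ← h1, ← h2]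
    simp
  rw [heq]
  exact sum_mem fun k _ => heγ k

end SqMul

/-! ### The number of binary digits equal to one -/

section BinWeight

/-- The number of binary digits equal to `1`. -/
def binWeight (n : ℕ) : ℕ := (Nat.digits 2 n).sum

theorem binWeight_two_mul (n : ℕ) : binWeight (2 * n) = binWeight n := by
  rcases Nat.eq_zero_or_pos n with rfl | h
  · simp
  · rw [binWeight, Nat.digits_def' (by norm_num) (by omega)]
    simp [binWeight]

theorem binWeight_two_mul_add_one (n : ℕ) : binWeight (2 * n + 1) = binWeight n + 1 := by
  rw [binWeight, Nat.digits_def' (by norm_num) (by omega)]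
  have h1 : (2 * n + 1) % 2 = 1 := by omega
  have h2 : (2 * n + 1) / 2 = n := by omega
  rw [h1, h2, List.sum_cons, add_comm, binWeight]

theorem two_pow_binWeight_le (n : ℕ) : 2 ^ binWeight n ≤ n + 1 := by
  induction n using Nat.strong_induction_on with
  | _ n ih =>
    obtain ⟨j, rfl | rfl⟩ := Nat.even_or_odd' n
    · rcases Nat.eq_zero_or_pos j with rfl | h
      · simp [binWeight]
      · rw [binWeight_two_mul]
        exact (ih j (by omega)).trans (by omega)
    · rw [binWeight_two_mul_add_one, pow_succ]
      have := ih j (by omega)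
      omega

theorem binWeight_pos {n : ℕ} (hn : n ≠ 0) : 0 < binWeight n := by
  induction n using Nat.strong_induction_on with
  | _ n ih =>
    obtain ⟨j, rfl | rfl⟩ := Nat.even_or_odd' n
    · rw [binWeight_two_mul]
      exact ih j (by omega) (by omega)
    · rw [binWeight_two_mul_add_one]; omega

/-- That is `v₂(i + 1) = s(i) + 1 - s(i + 1)`: adding one turns the trailing ones of `i` into zeros.
It is the bookkeeping for one step of the linear recurrence. -/
theorem two_pow_binWeight_mul (i : ℕ) :
    ∃ o, 2 ^ binWeight (i + 1) * (i + 1) = 2 ^ (binWeight i + 1) * (1 + 2 * o) := by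
  induction i using Nat.strong_induction_on with
  | _ i ih =>
    obtain ⟨j, rfl | rfl⟩ := Nat.even_or_odd' i
    · refine ⟨j, ?_⟩
      rw [binWeight_two_mul_add_one, binWeight_two_mul]; ring
    · obtain ⟨o, ho⟩ := ih j (by omega)
      refine ⟨o, ?_⟩
      rw [show 2 * j + 1 + 1 = 2 * (j + 1) by ring, binWeight_two_mul, binWeight_two_mul_add_one]
      rw [pow_succ 2 (binWeight j + 1), mul_right_comm, ← ho]; ring

/-- Legendre's formula `v₂(k!) = k - s(k)`, by telescoping. -/
theorem factorial_mul_two_pow (k : ℕ) :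
    ∃ o, k.factorial * 2 ^ binWeight k = 2 ^ k * (1 + 2 * o) := by
  induction k with
  | zero => exact ⟨0, by simp [binWeight]⟩
  | succ k ih =>
    obtain ⟨o, ho⟩ := ih
    obtain ⟨o', ho'⟩ := two_pow_binWeight_mul k
    refine ⟨o + o' + 2 * o * o', ?_⟩
    calc (k + 1).factorial * 2 ^ binWeight (k + 1)
        = k.factorial * (2 ^ binWeight (k + 1) * (k + 1)) := by rw [Nat.factorial_succ]; ring
      _ = 2 * (k.factorial * 2 ^ binWeight k) * (1 + 2 * o') := by rw [ho']; ring
      _ = _ := by rw [ho]; ring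

end BinWeight

/-! ### Stability of the solutions -/

section LinOp

open PowerSeries

variable {R : Type*} [CommRing R]

theorem coeff_X_mul_derivative (f : R⟦X⟧) (i : ℕ) :
    coeff i (X * derivative R f) = i * coeff i f := by
  cases i with
  | zero => simp
  | succ i => rw [coeff_succ_X_mul, coeff_derivative]; push_cast; ring

theorem coeff_linOp (a : R) (y : R⟦X⟧) (i : ℕ) :
    coeff i (linOp a y) = i * coeff (i - 1) y - 2 * a * (2 * i + 1) * coeff i y := by
  have e : linOp a y = X * (X * derivative R y + y) - C (4 * a) * (X * derivative R y) -
      C (2 * a) * y := by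
    rw [linOp, map_mul, map_mul, map_ofNat C 4, map_ofNat C 2]; ring
  rw [e, map_sub, map_sub, coeff_C_mul, coeff_C_mul, coeff_X_mul_derivative]
  cases i with
  | zero => simp
  | succ i =>
    rw [coeff_succ_X_mul, map_add, coeff_X_mul_derivative, Nat.add_sub_cancel]
    push_cast; ring

theorem linOp_add (a : R) (y z : R⟦X⟧) : linOp a (y + z) = linOp a y + linOp a z := by
  simp only [linOp, map_add]; ring

variable {A : Type*} [CommRing A] [IsDomain A] [CharZero A]

/-- One step of the recursion solving `linOp a y = f`, with control of the denominators. -/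
theorem dvd_two_pow_binWeight_mul (h2 : ∀ x : A, IsUnit (1 + 2 * x)) {a : A} (ha : IsUnit a)
    {i : ℕ} {d e φ μ : A} (hd : 2 * a * (2 * i + 1) * d = i * e - φ)
    (he : i ≠ 0 → μ ∣ 2 ^ binWeight (i - 1) * e) (hφ : 2 * μ ∣ φ) :
    μ ∣ 2 ^ binWeight i * d := by
  have hu : IsUnit (a * (2 * (i : A) + 1)) := by
    rw [add_comm]; exact ha.mul (h2 i)
  have key : 2 * μ ∣ 2 * (a * (2 * (i : A) + 1) * (2 ^ binWeight i * d)) := by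
    have e1 : 2 * (a * (2 * (i : A) + 1) * (2 ^ binWeight i * d)) =
        2 ^ binWeight i * i * e - 2 ^ binWeight i * φ := by
      linear_combination 2 ^ binWeight i * hd
    rw [e1]
    refine dvd_sub ?_ (hφ.mul_left _)
    cases i with
    | zero => simp
    | succ j =>
      obtain ⟨o, ho⟩ := two_pow_binWeight_mul j
      have ho' : (2 : A) ^ binWeight (j + 1) * ((j + 1 : ℕ) : A) =
          2 ^ (binWeight j + 1) * (1 + 2 * (o : A)) := mod_cast congrArg (Nat.cast (R := A)) ho
      rw [ho', pow_succ, show (2 : A) ^ binWeight j * 2 * (1 + 2 * (o : A)) * e =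
        2 * (2 ^ binWeight j * e) * (1 + 2 * o) by ring]
      exact (mul_dvd_mul_left 2 (he (by omega))).mul_right _
  exact (hu.dvd_mul_left).1 ((mul_dvd_mul_iff_left two_ne_zero).1 key)

theorem dvd_of_two_pow_binWeight_mul {ν x : A} {i ℓ : ℕ} (hi : binWeight i ≤ ℓ)
    (h : 2 ^ ℓ * ν ∣ 2 ^ binWeight i * x) : ν ∣ x := by
  have h0 : (2 : A) ^ binWeight i ≠ 0 := pow_ne_zero _ two_ne_zero
  rw [← Nat.add_sub_cancel' hi, pow_add, mul_assoc] at h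
  exact dvd_of_mul_left_dvd ((mul_dvd_mul_iff_left h0).1 h)

/-- Each step divides by `2` but multiplies by `i`; the accumulated loss in degree `i` is `1 +
binWeight i` digits, which is logarithmic in `i` and not linear. -/
theorem mem_coeffIdeal_of_linOp_mem (h2 : ∀ x : A, IsUnit (1 + 2 * x)) {a : A} (ha : IsUnit a)
    {ν : A} {ℓ m : ℕ} (hm : ∀ i < m, binWeight i ≤ ℓ) {y : A⟦X⟧}
    (hy : linOp a y ∈ coeffIdeal (2 * (2 ^ ℓ * ν)) m) : y ∈ coeffIdeal ν m := by
  have key : ∀ i < m, 2 ^ ℓ * ν ∣ 2 ^ binWeight i * coeff i y := by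
    intro i
    induction i with
    | zero =>
      intro hi
      exact dvd_two_pow_binWeight_mul h2 ha (e := 0) (φ := coeff 0 (linOp a y))
        (by rw [coeff_linOp]; simp) (by simp) (hy 0 hi)
    | succ i ih =>
      intro hi
      exact dvd_two_pow_binWeight_mul h2 ha (e := coeff i y) (φ := coeff (i + 1) (linOp a y))
        (by rw [coeff_linOp]; simp) (fun _ => ih (by omega)) (hy _ hi)
  exact fun i hi => dvd_of_two_pow_binWeight_mul (hm i hi) (key i hi)

theorem exists_factorial_mul_eq_two_pow (h2 : ∀ x : A, IsUnit (1 + 2 * x)) (k : ℕ) :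
    ∃ e : A, ((k + 1).factorial : A) * e = 2 ^ k := by
  obtain ⟨o, ho⟩ := factorial_mul_two_pow (k + 1)
  obtain ⟨b, hb⟩ := Nat.exists_eq_succ_of_ne_zero (binWeight_pos (Nat.succ_ne_zero k)).ne'
  obtain ⟨v, hv⟩ := (h2 o).exists_right_inv
  have ho' : ((k + 1).factorial : A) * 2 ^ b = 2 ^ k * (1 + 2 * (o : A)) := by
    have : ((k + 1).factorial : A) * 2 ^ (b + 1) = 2 ^ (k + 1) * (1 + 2 * (o : A)) := by
      rw [hb] at ho; exact_mod_cast congrArg (Nat.cast (R := A)) ho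
    refine mul_left_cancel₀ (two_ne_zero (α := A)) ?_
    linear_combination this
  exact ⟨2 ^ b * v, by linear_combination v * ho' + 2 ^ k * hv⟩

end LinOp

/-! ### Stability of the nonlinear equation: one more coefficient -/

section Stability

open PowerSeries

variable {A : Type*} [CommRing A]

theorem mul_mem_coeffIdeal_mul {c d : A} {m : ℕ} {f g : A⟦X⟧} (hf : f ∈ coeffIdeal c m)
    (hg : g ∈ coeffIdeal d m) : f * g ∈ coeffIdeal (c * d) m := by
  intro i hi
  rw [coeff_mul]
  refine Finset.dvd_sum fun p hp => ?_
  have := Finset.HasAntidiagonal.mem_antidiagonal.1 hp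
  exact mul_dvd_mul (hf _ (by omega)) (hg _ (by omega))

theorem mul_mem_coeffIdeal_succ {c d r : A} {j : ℕ} (hj : 1 ≤ j) {f g : A⟦X⟧}
    (hf : f ∈ coeffIdeal c (j + 1)) (hf' : f ∈ coeffIdeal (r * c) j)
    (hg : g ∈ coeffIdeal d (j + 1)) (hg' : g ∈ coeffIdeal (r * d) j) :
    f * g ∈ coeffIdeal (r * (c * d)) (j + 1) := by
  intro i hi
  rw [coeff_mul]
  refine Finset.dvd_sum fun p hp => ?_
  have := Finset.HasAntidiagonal.mem_antidiagonal.1 hp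
  rcases lt_or_ge p.1 j with h | h
  · have := mul_dvd_mul (hf' p.1 h) (hg p.2 (by omega))
    rwa [mul_assoc] at this
  · have := mul_dvd_mul (hf p.1 (by omega)) (hg' p.2 (by omega))
    rwa [mul_left_comm] at this

/-- In degree at most `j` with `j ≥ 1`, every product of two coefficients has a factor of degree
less than `j`, which brings an extra `4`. -/
theorem pow_mem_coeffIdeal {ν : A} {j : ℕ} (hj : 1 ≤ j) {p : A⟦X⟧}
    (hp : p ∈ coeffIdeal ν (j + 1)) (hp' : p ∈ coeffIdeal (4 * ν) j) (k : ℕ) :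
    p ^ (k + 1) ∈ coeffIdeal (4 ^ k * ν ^ (k + 1)) (j + 1) ∧
      p ^ (k + 1) ∈ coeffIdeal (4 * (4 ^ k * ν ^ (k + 1))) j := by
  induction k with
  | zero => simpa using ⟨hp, hp'⟩
  | succ k ih =>
    rw [pow_succ p]
    constructor
    · convert mul_mem_coeffIdeal_succ hj ih.1 ih.2 hp hp' using 2; ring
    · convert mul_mem_coeffIdeal_mul ih.2 hp' using 2; ring

/-- With `γ k = p ^ k / k!` and `f k` the `k`-th derivative of `W ^ (-1/2)` at `q`, the sum on the
left is the truncated integral of `W ^ (-1/2)` from `q` to `q + p`. The recurrence on `f` makes the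
terms telescope, and the last summand is the truncation error. -/
theorem linOp_sum_eq {l a : A} {q p : A⟦X⟧} {f γ : ℕ → A⟦X⟧}
    (hf : ∀ k : ℕ, dSeries l a q * f (k + 1) = X * (X - 4 * C a) * derivative A (f k) -
        (2 * (k : A⟦X⟧) + 1) * (X - 2 * C a) * f k)
    (hγ0 : γ 0 = 1) (hγ : ∀ k : ℕ, ((k : A⟦X⟧) + 1) * γ (k + 1) = p * γ k)
    (hγ' : ∀ k : ℕ, derivative A (γ (k + 1)) = derivative A p * γ k) (N : ℕ) :
    linOp a (∑ k ∈ Finset.range N, f k * γ (k + 1)) =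
      dSeries l a (q + p) * (∑ k ∈ Finset.range N, f k * γ k) - dSeries l a q * f 0 +
        dSeries l a q * f N * γ N := by
  induction N with
  | zero => simp [linOp, hγ0]
  | succ N ih =>
    rw [Finset.sum_range_succ, Finset.sum_range_succ, linOp_add, ih]
    have h1 : linOp a (f N * γ (N + 1)) =
        X * (X - 4 * C a) * derivative A (f N) * γ (N + 1) +
          X * (X - 4 * C a) * derivative A p * f N * γ N +
          (X - 2 * C a) * f N * γ (N + 1) := by
      rw [linOp, Derivation.leibniz, hγ', smul_eq_mul, smul_eq_mul]; ring
    have hD : dSeries 0 a p = (2 * X - 4 * C a) * p + X * (X - 4 * C a) * derivative A p := by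
      rw [dSeries_eq, map_zero, zero_add]
    rw [h1, dSeries_add, hD]
    linear_combination -γ (N + 1) * hf N + 2 * (X - 2 * C a) * f N * hγ N

variable [CharZero A]

theorem natCast_powerSeries_ne_zero {k : ℕ} (hk : k ≠ 0) : (k : A⟦X⟧) ≠ 0 := by
  rw [← map_natCast (C (R := A))]
  exact fun h => hk (Nat.cast_injective (R := A) (C_injective (by simpa using h)))

variable [IsDomain A]

/-- The inductive step of stability: the coefficient of degree `j`, known only up to a factor `4`
less than the lower ones, reaches the same precision `8 * ν`. -/
theorem two_mul_mem_coeffIdeal_of_defect (h2 : ∀ x : A, IsUnit (1 + 2 * x)) {l a : A}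
    (ha : IsUnit a) {u : A⟦X⟧} (hu : IsUnit u) {w : Polynomial A} {q : A⟦X⟧} {n : ℕ}
    (hz : IsUnit (dSeries l a q)) (hq : X ^ n ∣ defect l a u w q) {ν : A} {ℓ j : ℕ} (hj : 1 ≤ j)
    (hjn : j + 1 ≤ n) (hℓ : ∀ i < j + 1, binWeight i ≤ ℓ) {p : A⟦X⟧}
    (hp : p ∈ coeffIdeal ν (j + 1)) (hp' : p ∈ coeffIdeal (4 * ν) j)
    (hd : defect l a u w (q + 2 * p) ∈ coeffIdeal (2 ^ (ℓ + 2) * (8 * ν)) (j + 1)) :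
    2 * p ∈ coeffIdeal (8 * ν) (j + 1) := by
  obtain ⟨ui, hui⟩ := hu.exists_right_inv
  obtain ⟨zi, hzi⟩ := hz.exists_right_inv
  choose e he using exists_factorial_mul_eq_two_pow (A := A) h2
  -- `γ k` is `(2p) ^ k / k!`; it is integral because `e k = 2 ^ k / (k + 1)!` is.
  obtain ⟨γ, hγ0, hγs⟩ : ∃ γ : ℕ → A⟦X⟧, γ 0 = 1 ∧ ∀ k, γ (k + 1) = C (2 * e k) * p ^ (k + 1) :=
    ⟨fun k => Nat.casesOn k 1 fun k => C (2 * e k) * p ^ (k + 1), rfl, fun _ => rfl⟩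
  -- `f 0` is the inverse of `u z`, a square root of `W(t, q)` modulo `t ^ n`.
  obtain ⟨f, hf0, hfs⟩ : ∃ f : ℕ → A⟦X⟧, f 0 = zi * ui ∧ ∀ k : ℕ, f (k + 1) =
      zi * (X * (X - 4 * C a) * derivative A (f k) -
        (2 * (k : A⟦X⟧) + 1) * (X - 2 * C a) * f k) :=
    ⟨fun k => Nat.rec (zi * ui) (fun k g => zi * (X * (X - 4 * C a) * derivative A g -
        (2 * (k : A⟦X⟧) + 1) * (X - 2 * C a) * g)) k, rfl, fun _ => rfl⟩
  set z := dSeries l a q with hzdef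
  have hf : ∀ k : ℕ, z * f (k + 1) = X * (X - 4 * C a) * derivative A (f k) -
        (2 * (k : A⟦X⟧) + 1) * (X - 2 * C a) * f k := fun k => by
    rw [hfs, ← mul_assoc, hzi, one_mul]
  have hγfac : ∀ k : ℕ, (k.factorial : A⟦X⟧) * γ k = (2 * p) ^ k := by
    rintro (_ | k)
    · simp [hγ0]
    · have := congrArg (C (R := A)) (he k)
      rw [map_mul, map_natCast, map_pow, map_ofNat] at this
      rw [hγs, mul_pow, map_mul, map_ofNat]
      linear_combination 2 * p ^ (k + 1) * this
  have hγ1 : ∀ k : ℕ, ((k : A⟦X⟧) + 1) * γ (k + 1) = 2 * p * γ k := by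
    intro k
    refine mul_left_cancel₀ (natCast_powerSeries_ne_zero k.factorial_ne_zero) ?_
    have h1 := hγfac (k + 1)
    rw [Nat.factorial_succ, pow_succ] at h1
    push_cast at h1
    linear_combination h1 - 2 * p * hγfac k
  have hγ' : ∀ k : ℕ, derivative A (γ (k + 1)) = derivative A (2 * p) * γ k := by
    intro k
    refine mul_left_cancel₀ (natCast_powerSeries_ne_zero (k + 1).factorial_ne_zero) ?_
    have h1 := congrArg (derivative A) (hγfac (k + 1))
    rw [Derivation.leibniz, Derivation.map_natCast, Derivation.leibniz_pow, smul_zero, add_zero,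
      Nat.add_sub_cancel, ← hγfac k, Nat.factorial_succ] at h1
    simp only [smul_eq_mul, nsmul_eq_mul] at h1
    rw [Nat.factorial_succ]
    push_cast at h1 ⊢
    linear_combination h1
  have hγmem : ∀ k, γ (k + 2) ∈ coeffIdeal (4 ^ k * (8 * ν)) (j + 1) := by
    intro k
    rw [hγs]
    refine coeffIdeal_mono ?_ le_rfl
      (mul_mem_coeffIdeal_of_C (d := 2 * e (k + 1)) (pow_mem_coeffIdeal hj hp hp' (k + 1)).1)
    exact ⟨e (k + 1) * ν ^ (k + 1), by ring⟩
  set κ := 2 ^ (ℓ + 2) * (8 * ν) with hκ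
  -- From `k = ℓ + 4` on, `γ k` is a multiple of `4 ^ (ℓ + 2) * (8 * ν)`, hence of `κ`.
  obtain ⟨N, hN⟩ : ∃ N, N = ℓ + 3 := ⟨_, rfl⟩
  have hγN : ∀ k, N + 1 ≤ k → γ k ∈ coeffIdeal κ (j + 1) := by
    intro k hk
    obtain ⟨i, rfl⟩ := Nat.exists_eq_add_of_le' (show 2 ≤ k by omega)
    refine coeffIdeal_mono (mul_dvd_mul_right ?_ _) le_rfl (hγmem i)
    exact (pow_dvd_pow 2 (by omega)).trans (pow_dvd_pow_of_dvd (⟨2, by norm_num⟩ : (2 : A) ∣ 4) i)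
  have hzf : u * z * f 0 = 1 := by rw [hf0]; linear_combination hui * z * zi + hzi
  set F := ∑ k ∈ Finset.range (N + 1), f k * γ k with hF
  have h0 : X ^ n ∣ f 0 ^ 2 * wVal w X (C l) (C a) q - 1 := by
    have : f 0 ^ 2 * wVal w X (C l) (C a) q - 1 = f 0 ^ 2 * defect l a u w q := by
      rw [defect, ← hzdef]; linear_combination (u * z * f 0 + 1) * hzf
    rw [this]; exact hq.mul_left _
  have hsq : F ^ 2 * wVal w X (C l) (C a) (q + 2 * p) - 1 ∈ coeffIdeal κ (j + 1) :=
    sq_mul_wVal_sub_one_mem hz hf h0 hγfac hjn hγN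
  have hlin := linOp_sum_eq hf hγ0 hγ1 hγ' (N + 1)
  rw [← hF, ← hzdef] at hlin
  set Y := ∑ k ∈ Finset.range (N + 1), f k * γ (k + 1) with hY
  obtain ⟨G, hG⟩ : ∃ G, F = f 0 + 2 * p * G := by
    refine ⟨∑ k ∈ Finset.range N, f (k + 1) * (C (e k) * p ^ k), ?_⟩
    rw [hF, Finset.sum_range_succ', hγ0, mul_one, add_comm, Finset.mul_sum]
    congr 1
    refine Finset.sum_congr rfl fun k _ => ?_
    rw [hγs, map_mul, map_ofNat]; ring
  have hDp : dSeries l a (q + 2 * p) = z + 2 * dSeries 0 a p := by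
    rw [two_mul, dSeries_add, dSeries_add, two_mul]
  set D := u * (p * G * (z + 2 * dSeries 0 a p) + f 0 * dSeries 0 a p) with hD
  have hX : F * (z + 2 * dSeries 0 a p) * u = 1 + 2 * D := by
    rw [hG, hD]; linear_combination hzf
  -- The square of `1 + 2D` is `1 + 4D (1 + D)`. As `D` has an even constant term, `1 + D` is a
  -- unit: the sign of the square root is determined, and only one factor `2` is lost.
  have h4D : 4 * D * (1 + D) ∈ coeffIdeal κ (j + 1) := by
    have : 4 * D * (1 + D) = (F ^ 2 * wVal w X (C l) (C a) (q + 2 * p) - 1) -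
        F ^ 2 * defect l a u w (q + 2 * p) := by
      rw [defect, hDp]
      linear_combination (-(1 + 2 * D) - F * (z + 2 * dSeries 0 a p) * u) * hX
    rw [this]
    exact sub_mem hsq (Ideal.mul_mem_left _ _ hd)
  have hp0 : (2 : A) ∣ constantCoeff p := by
    have := hp' 0 (by omega)
    rw [coeff_zero_eq_constantCoeff] at this
    exact dvd_trans ⟨2 * ν, by ring⟩ this
  have hD0 : (2 : A) ∣ constantCoeff D := by
    rw [hD]
    simp only [map_mul, map_add, constantCoeff_dSeries]
    refine Dvd.dvd.mul_left (dvd_add ?_ ?_) _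
    · exact (hp0.mul_right _).mul_right _
    · refine Dvd.dvd.mul_left ?_ _
      rw [zero_sub, dvd_neg]
      exact hp0.mul_left _
  have hDu : IsUnit (1 + D) := by
    obtain ⟨x, hx⟩ := hD0
    rw [isUnit_iff_constantCoeff, map_add, map_one, hx]
    exact h2 x
  obtain ⟨Di, hDi⟩ := hDu.exists_right_inv
  have h4D' : 4 * D ∈ coeffIdeal κ (j + 1) := by
    have := Ideal.mul_mem_left _ Di h4D
    rwa [show Di * (4 * D * (1 + D)) = 4 * D by linear_combination 4 * D * hDi] at this
  have hκ' : κ = 2 * (2 * (2 ^ ℓ * (8 * ν))) := by rw [hκ]; ring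
  have h2D : 2 * D ∈ coeffIdeal (2 * (2 ^ ℓ * (8 * ν))) (j + 1) := by
    intro i hi
    have := h4D' i hi
    rw [show 4 * D = C (2 : A) * (2 * D) by rw [map_ofNat]; ring, coeff_C_mul, hκ'] at this
    exact (mul_dvd_mul_iff_left two_ne_zero).1 this
  have hlinY : linOp a Y ∈ coeffIdeal (2 * (2 ^ ℓ * (8 * ν))) (j + 1) := by
    have : linOp a Y = ui * (2 * D) + z * f (N + 1) * γ (N + 1) := by
      rw [hlin, hDp]
      linear_combination ui * hX - ui * hzf - F * (z + 2 * dSeries 0 a p) * hui + z * f 0 * hui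
    rw [this]
    refine add_mem (Ideal.mul_mem_left _ _ h2D) (Ideal.mul_mem_left _ _ ?_)
    exact coeffIdeal_mono ⟨2, by rw [hκ']; ring⟩ le_rfl (hγN (N + 1) le_rfl)
  have hYmem := mem_coeffIdeal_of_linOp_mem h2 ha hℓ hlinY
  have hγ1' : γ 1 = 2 * p := by
    have := hγ1 0
    simpa [hγ0] using this
  -- `Y` starts with `f 0 * (2 * p)`, and the divided powers from the second on are already
  -- multiples of `8 * ν`.
  have hfp : f 0 * (2 * p) ∈ coeffIdeal (8 * ν) (j + 1) := by
    have : f 0 * (2 * p) = Y - ∑ k ∈ Finset.range N, f (k + 1) * γ (k + 2) := by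
      rw [hY, Finset.sum_range_succ', hγ1', add_sub_cancel_left]
    rw [this]
    refine sub_mem hYmem (sum_mem fun k _ => Ideal.mul_mem_left _ _ ?_)
    exact coeffIdeal_mono (Dvd.intro_left _ rfl) le_rfl (hγmem k)
  have := Ideal.mul_mem_left _ (u * z) hfp
  rwa [← mul_assoc, hzf, one_mul] at this

end Stability

/-! ### Stability in all degrees and extension of approximate solutions -/

section Extension

open PowerSeries

variable {A : Type*} [CommRing A]

theorem isUnit_add_two_mul (h2 : ∀ x : A, IsUnit (1 + 2 * x)) {y : A} (hy : IsUnit y) (x : A) :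
    IsUnit (y + 2 * x) := by
  obtain ⟨v, hv⟩ := hy.exists_right_inv
  have : y + 2 * x = y * (1 + 2 * (v * x)) := by linear_combination -2 * x * hv
  rw [this]
  exact hy.mul (h2 _)

theorem coeff_mul_of_X_pow_dvd {j : ℕ} {f : A⟦X⟧} (hf : X ^ j ∣ f) (g : A⟦X⟧) :
    coeff j (f * g) = coeff j f * constantCoeff g := by
  obtain ⟨f, rfl⟩ := hf
  rw [mul_assoc, coeff_X_pow_mul', coeff_X_pow_mul']
  simp

theorem constantCoeff_aeval {x : A⟦X⟧} (hx : constantCoeff x = 0) (w : Polynomial A) :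
    constantCoeff (Polynomial.aeval x w) = w.coeff 0 := by
  rw [Polynomial.aeval_def, Polynomial.hom_eval₂, hx, Polynomial.eval₂_at_zero]
  simp

theorem constantCoeff_wVal (w : Polynomial A) (l a : A) (x : A⟦X⟧) :
    constantCoeff (wVal w X (C l) (C a) x) = (l - 4 * a * constantCoeff x) * l * w.coeff 0 := by
  rw [wVal, map_mul, constantCoeff_aeval (by simp)]
  simp [map_ofNat (constantCoeff (R := A)) 4]
  ring

theorem constantCoeff_wDer (w : Polynomial A) (l a : A) (x : A⟦X⟧) :
    constantCoeff (wDer w X (C l) (C a) x) = -4 * a * l * w.coeff 0 := by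
  rw [wDer, map_add, map_add, map_mul, constantCoeff_aeval (by simp)]
  simp [map_ofNat (constantCoeff (R := A)) 4]

theorem constantCoeff_defect (l a : A) (u : A⟦X⟧) (w : Polynomial A) (x : A⟦X⟧) :
    constantCoeff (defect l a u w x) = (l - 4 * a * constantCoeff x) * l * w.coeff 0 -
      constantCoeff u ^ 2 * (l - 4 * a * constantCoeff x) ^ 2 := by
  rw [defect, map_sub, map_mul, map_pow, map_pow, constantCoeff_wVal, constantCoeff_dSeries]

/-- The leading term of the variation of the defect. -/
theorem coeff_defect_add (l a : A) (u : A⟦X⟧) (w : Polynomial A) {j : ℕ} (hj : 1 ≤ j) (x : A⟦X⟧)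
    {y : A⟦X⟧} (hy : X ^ j ∣ y) :
    coeff j (defect l a u w (x + y)) = coeff j (defect l a u w x) +
      coeff j y * (-4 * a * l * w.coeff 0 +
        8 * a * (j + 1) * constantCoeff u ^ 2 * (l - 4 * a * constantCoeff x)) := by
  obtain ⟨r, hr⟩ := wVal_add w X (C l) (C a) x y
  have hD : X ^ j ∣ dSeries 0 a y :=
    mem_coeffIdeal_zero.1 (dSeries_mem_coeffIdeal (mem_coeffIdeal_zero.2 hy))
  have hDj : coeff j (dSeries 0 a y) = -4 * a * (j + 1) * coeff j y := by
    have : dSeries 0 a y = X * (X * derivative A y) + X * (2 * y) -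
        C (4 * a) * (y + X * derivative A y) := by
      rw [dSeries_eq, map_zero, map_mul, map_ofNat]; ring
    obtain ⟨i, rfl⟩ := Nat.exists_eq_add_of_le' hj
    have hyi : coeff i y = 0 := X_pow_dvd_iff.1 hy i (by omega)
    rw [this, map_sub, map_add, coeff_C_mul, map_add, coeff_succ_X_mul, coeff_succ_X_mul,
      coeff_X_mul_derivative, coeff_X_mul_derivative, two_mul y, map_add, hyi]
    push_cast; ring
  have hy0 : constantCoeff y = 0 := by
    rw [← coeff_zero_eq_constantCoeff]; exact X_pow_dvd_iff.1 hy 0 (by omega)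
  have hD0 : constantCoeff (dSeries 0 a y) = 0 := by
    rw [← coeff_zero_eq_constantCoeff]; exact X_pow_dvd_iff.1 hD 0 (by omega)
  have e : defect l a u w (x + y) = defect l a u w x + y * (wDer w X (C l) (C a) x + r * y) -
      dSeries 0 a y * (u ^ 2 * (2 * dSeries l a x + dSeries 0 a y)) := by
    simp only [defect, hr, dSeries_add]; ring
  rw [e, map_sub, map_add, coeff_mul_of_X_pow_dvd hy, coeff_mul_of_X_pow_dvd hD, hDj]
  simp only [map_mul, map_add, map_pow, constantCoeff_wDer, constantCoeff_dSeries, hy0, hD0,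
    map_ofNat]
  ring

/-- `q` is a solution modulo `t ^ n`, and the data are invertible. -/
structure IsSolutionMod (l a : A) (u : A⟦X⟧) (w : Polynomial A) (q : A⟦X⟧) (n : ℕ) : Prop where
  isUnit_a : IsUnit a
  isUnit_u : IsUnit u
  isUnit_dSeries : IsUnit (dSeries l a q)
  X_pow_dvd : X ^ n ∣ defect l a u w q

namespace IsSolutionMod

variable {l a : A} {u : A⟦X⟧} {w : Polynomial A} {q : A⟦X⟧} {n : ℕ}

theorem isUnit_first (h : IsSolutionMod l a u w q n) : IsUnit (l - 4 * a * constantCoeff q) := by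
  rw [← constantCoeff_dSeries]; exact h.isUnit_dSeries.map _

theorem l_mul_coeff_zero (h : IsSolutionMod l a u w q n) (hn : 1 ≤ n) :
    l * w.coeff 0 = constantCoeff u ^ 2 * (l - 4 * a * constantCoeff q) := by
  have h0 := X_pow_dvd_iff.1 h.X_pow_dvd 0 (by omega)
  rw [coeff_zero_eq_constantCoeff, constantCoeff_defect] at h0
  refine h.isUnit_first.mul_left_cancel ?_
  linear_combination h0

theorem isUnit_u_zero (h : IsSolutionMod l a u w q n) : IsUnit (constantCoeff u) :=
  h.isUnit_u.map _

/-- At `x = q` the relation `l w_0 = u_0² (l - 4 a q_0)` reduces the factor in `coeff_defect_add` to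
`4 a u_0² (l - 4 a q_0) (2j + 1)`. Another `x` changes it by a multiple of `8`, so it remains `4`
times a unit. -/
theorem exists_coeff_defect_add (h : IsSolutionMod l a u w q n) (h2 : ∀ x : A, IsUnit (1 + 2 * x))
    (hn : 1 ≤ n) {j : ℕ} (hj : 1 ≤ j) (x : A⟦X⟧) :
    ∃ v : A, IsUnit v ∧ ∀ c, coeff j (defect l a u w (x + C c * X ^ j)) =
      coeff j (defect l a u w x) + 4 * v * c := by
  refine ⟨a * constantCoeff u ^ 2 * ((l - 4 * a * constantCoeff q) * (1 + 2 * (j : A)) +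
    2 * (4 * a * (j + 1) * (constantCoeff q - constantCoeff x))), ?_, fun c => ?_⟩
  · exact (h.isUnit_a.mul (h.isUnit_u_zero.pow 2)).mul
      (isUnit_add_two_mul h2 (h.isUnit_first.mul (h2 _)) _)
  · rw [coeff_defect_add l a u w hj x (Dvd.intro_left _ rfl)]
    have : coeff j (C c * X ^ j : A⟦X⟧) = c := by simp
    rw [this]
    linear_combination (-4 * a * c) * h.l_mul_coeff_zero hn

variable [IsDomain A] [CharZero A]

/-- An approximate solution at the working precision is close to the solution. -/
theorem mem_coeffIdeal_of_defect (h : IsSolutionMod l a u w q n)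
    (h2 : ∀ x : A, IsUnit (1 + 2 * x)) {ℓ : ℕ} (hℓ : ∀ i < n, binWeight i ≤ ℓ) {ν : A} {m : ℕ}
    (hm : m ≤ n) {p : A⟦X⟧}
    (hd : defect l a u w (q + p) ∈ coeffIdeal (2 ^ (ℓ + 2) * (8 * ν)) m) :
    p ∈ coeffIdeal (8 * ν) m := by
  induction m with
  | zero => exact fun i hi => absurd hi (by omega)
  | succ j ih =>
    have ih := ih (by omega) (coeffIdeal_mono dvd_rfl j.le_succ hd)
    have h4 : (4 : A) ≠ 0 := mod_cast Nat.cast_ne_zero (R := A).2 (by norm_num : (4 : ℕ) ≠ 0)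
    rcases Nat.eq_zero_or_pos j with rfl | hj
    · intro i hi
      obtain rfl : i = 0 := by omega
      have h0 := hd 0 (by omega)
      have hlw := h.l_mul_coeff_zero (by omega)
      rw [coeff_zero_eq_constantCoeff, constantCoeff_defect, map_add] at h0
      rw [coeff_zero_eq_constantCoeff]
      have hu : IsUnit ((l - 4 * a * constantCoeff q + 2 * (-2 * a * constantCoeff p)) *
          constantCoeff u ^ 2 * a) :=
        ((isUnit_add_two_mul h2 h.isUnit_first _).mul (h.isUnit_u_zero.pow 2)).mul h.isUnit_a
      have e : (l - 4 * a * (constantCoeff q + constantCoeff p)) * l * w.coeff 0 -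
          constantCoeff u ^ 2 * (l - 4 * a * (constantCoeff q + constantCoeff p)) ^ 2 =
          (l - 4 * a * constantCoeff q + 2 * (-2 * a * constantCoeff p)) *
          constantCoeff u ^ 2 * a * (4 * constantCoeff p) := by
        linear_combination (l - 4 * a * (constantCoeff q + constantCoeff p)) * hlw
      rw [e, hu.dvd_mul_left, show (2 : A) ^ (ℓ + 2) * (8 * ν) = 4 * (2 ^ ℓ * (8 * ν)) by ring,
        mul_dvd_mul_iff_left h4] at h0
      exact dvd_of_mul_left_dvd h0
    -- The lower coefficients of `p` can be discarded modulo `8 * ν`, so the defect in degree `j` is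
    -- `4 v p_j` with `v` a unit.
    · have hpj : 8 * ν ∣ 4 * coeff j p := by
        obtain ⟨v, hv, hvc⟩ := h.exists_coeff_defect_add h2 (by omega) hj q
        have hmem : defect l a u w (q + C (coeff j p) * X ^ j) ∈ coeffIdeal (8 * ν) (j + 1) := by
          refine defect_mem_congr (x := q + p) ?_
            (coeffIdeal_mono (Dvd.intro_left _ rfl) le_rfl hd)
          rw [add_sub_add_left_eq_sub]
          intro i hi
          rw [map_sub, coeff_C_mul, coeff_X_pow]
          split_ifs with hij
          · subst hij; simp
          · simpa using ih i (by omega)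
        have h1 := hmem j (by omega)
        rw [hvc, X_pow_dvd_iff.1 h.X_pow_dvd j (by omega), zero_add, mul_comm 4 v, mul_assoc,
          hv.dvd_mul_left] at h1
        exact h1
      -- Halving turns the divisibility by `8 * ν` below `j` into `4 * ν`, and that by `2 * ν` at
      -- `j` into `ν`. Coefficients beyond `j` are unconstrained, hence the truncation.
      have hp₁ : ∀ i, ∃ c, coeff i (truncT (j + 1) p) = 2 * c ∧ (i < j + 1 → ν ∣ c) ∧
          (i < j → 4 * ν ∣ c) := by
        intro i
        rcases lt_trichotomy i j with hi | rfl | hi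
        · obtain ⟨c, hc⟩ := ih i hi
          refine ⟨4 * ν * c, ?_, fun _ => ⟨4 * c, by ring⟩, fun _ => ⟨c, rfl⟩⟩
          rw [coeff_truncT, if_pos (by omega), hc]; ring
        · obtain ⟨c, hc⟩ := hpj
          refine ⟨ν * c, ?_, fun _ => ⟨c, rfl⟩, fun hi => absurd hi (lt_irrefl _)⟩
          rw [coeff_truncT, if_pos (by omega)]
          exact mul_left_cancel₀ h4 (by linear_combination hc)
        · exact ⟨0, by rw [coeff_truncT, if_neg (by omega), mul_zero], fun _ => dvd_zero _,
            fun _ => dvd_zero _⟩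
      choose c hc1 hc2 hc3 using hp₁
      have hp : truncT (j + 1) p = 2 * PowerSeries.mk c := by
        ext i
        rw [hc1, ← map_ofNat C 2, coeff_C_mul, coeff_mk]
      have hcongr : truncT (j + 1) p - p ∈ coeffIdeal (2 ^ (ℓ + 2) * (8 * ν)) (j + 1) :=
        coeffIdeal_of_X_pow_dvd (X_pow_dvd_truncT_sub _ _)
      have hmem := two_mul_mem_coeffIdeal_of_defect h2 h.isUnit_a h.isUnit_u h.isUnit_dSeries
        h.X_pow_dvd (ν := ν) (p := PowerSeries.mk c) hj hm (fun i hi => hℓ i (by omega))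
        (fun i hi => by rw [coeff_mk]; exact hc2 i hi)
        (fun i hi => by rw [coeff_mk]; exact hc3 i hi)
        (defect_mem_congr (x := q + p) (by rwa [← hp, add_sub_add_left_eq_sub]) hd)
      rw [← hp] at hmem
      intro i hi
      have := hmem i hi
      rwa [coeff_truncT, if_pos hi] at this

/-- An approximate solution modulo `t ^ m` can be extended modulo `t ^ n`. -/
theorem exists_extension (h : IsSolutionMod l a u w q n)
    (h2 : ∀ x : A, IsUnit (1 + 2 * x)) {ℓ : ℕ} (hℓ : ∀ i < n, binWeight i ≤ ℓ) {ν : A} {m : ℕ}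
    (hm1 : 1 ≤ m) (x : A⟦X⟧)
    (hd : defect l a u w x ∈ coeffIdeal (2 ^ (ℓ + 2) * (8 * ν)) m) {k : ℕ} (hmk : m ≤ k)
    (hk : k ≤ n) :
    ∃ y : A⟦X⟧, X ^ m ∣ y - x ∧ defect l a u w y ∈ coeffIdeal (2 ^ (ℓ + 2) * (8 * ν)) k := by
  induction k, hmk using Nat.le_induction with
  | base => exact ⟨x, by simp, hd⟩
  | succ j hmj ih =>
    obtain ⟨y, hyx, hy⟩ := ih (by omega)
    obtain ⟨v, hv, hvc⟩ := h.exists_coeff_defect_add h2 (by omega) (hm1.trans hmj) y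
    have hyq : y - q ∈ coeffIdeal (8 * ν) j :=
      h.mem_coeffIdeal_of_defect h2 hℓ (by omega) (by rwa [add_sub_cancel])
    -- Replacing the coefficient of degree `j` by that of `q` kills the defect modulo `8 * ν`, while
    -- it changes the defect in degree `j` by a multiple of `4`. So that coefficient of the defect
    -- was divisible by `4` and can be cancelled by an integral choice.
    have hmem : defect l a u w (y + C (coeff j q - coeff j y) * X ^ j) ∈
        coeffIdeal (8 * ν) (j + 1) := by
      refine defect_mem_congr (x := q) ?_ (coeffIdeal_of_X_pow_dvd ((pow_dvd_pow X hk).trans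
        h.X_pow_dvd))
      intro i hi
      rw [map_sub, map_add, coeff_C_mul, coeff_X_pow]
      split_ifs with hij
      · subst hij; simp
      · simpa using hyq i (by omega)
    have h1 := hmem j (by omega)
    rw [hvc] at h1
    obtain ⟨d, hd4⟩ : (4 : A) ∣ coeff j (defect l a u w y) := by
      have h3 : (4 : A) ∣ 8 * ν := ⟨2 * ν, by ring⟩
      have := h3.trans h1
      rw [mul_assoc] at this
      exact (dvd_add_left (dvd_mul_right _ _)).1 this
    obtain ⟨vi, hvi⟩ := hv.exists_right_inv
    refine ⟨y + C (-vi * d) * X ^ j, ?_, fun i hi => ?_⟩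
    · rw [add_sub_right_comm]
      exact dvd_add hyx ((pow_dvd_pow X hmj).mul_left _)
    · rcases Nat.lt_succ_iff_lt_or_eq.1 hi with hij | rfl
      · exact defect_mem_congr (m := j) (by
          rw [add_sub_cancel_left]
          exact coeffIdeal_of_X_pow_dvd (Dvd.intro_left _ rfl)) hy i hij
      · rw [hvc, hd4, show 4 * d + 4 * v * (-vi * d) = 4 * d * (1 - v * vi) by ring, hvi]
        simp

end IsSolutionMod

end Extension

/-! ### Total correctness of computations -/

namespace Run

/-- No execution of `m` raises an error, some execution returns, and every returned value
satisfies `P`. -/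
def Ensures {α : Type*} (m : Run α) (P : α → Prop) : Prop :=
  ¬ m.HasOutcome none ∧ (∃ x, m.HasOutcome (some x)) ∧ ∀ x, m.HasOutcome (some x) → P x

theorem Ensures.mono {α : Type*} {m : Run α} {P Q : α → Prop} (h : m.Ensures P)
    (hPQ : ∀ x, P x → Q x) : m.Ensures Q :=
  ⟨h.1, h.2.1, fun x hx => hPQ x (h.2.2 x hx)⟩

theorem ensures_pure {α : Type*} {x : α} {P : α → Prop} (h : P x) :
    (pure x : Run α).Ensures P := by
  refine ⟨fun h => ?_, ⟨x, rfl⟩, fun y hy => ?_⟩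
  · exact Option.some_ne_none x h.symm
  · obtain rfl : y = x := Option.some.inj hy
    exact h

theorem Ensures.bind {α β : Type u} {m : Run α} {f : α → Run β} {P : α → Prop} {Q : β → Prop}
    (hm : m.Ensures P) (hf : ∀ x, P x → (f x).Ensures Q) : (m >>= f).Ensures Q := by
  refine ⟨?_, ?_, ?_⟩
  · rintro (⟨h, -⟩ | ⟨x, hx, h⟩)
    · exact hm.1 h
    · exact (hf x (hm.2.2 x hx)).1 h
  · obtain ⟨x, hx⟩ := hm.2.1
    obtain ⟨y, hy⟩ := (hf x (hm.2.2 x hx)).2.1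
    exact ⟨y, Or.inr ⟨x, hx, hy⟩⟩
  · rintro y (⟨-, h⟩ | ⟨x, hx, h⟩)
    · exact absurd h (Option.some_ne_none y)
    · exact (hf x (hm.2.2 x hx)).2.2 y h

theorem ensures_choose {α : Type*} {s : Set α} {P : α → Prop} (hne : s.Nonempty)
    (h : ∀ x ∈ s, P x) : (choose s).Ensures P := by
  refine ⟨?_, ?_, ?_⟩
  · rintro ⟨x, -, hx⟩
    exact Option.some_ne_none x hx.symm
  · obtain ⟨x, hx⟩ := hne
    exact ⟨x, x, hx, rfl⟩
  · rintro x ⟨y, hy, hxy⟩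
    obtain rfl : x = y := Option.some.inj hxy
    exact h x hy

end Run

/-! ### Divisions in fixed point arithmetic -/

section Division

open PowerSeries

variable {A : Type*} [CommRing A] {ϖ : A} {k e : ℕ}

theorem reduce_eq_iff {x y : A} : reduce ϖ k x = reduce ϖ k y ↔ ϖ ^ k ∣ x - y := by
  rw [Ideal.Quotient.eq, Ideal.mem_span_singleton]

theorem reduce_out (x : Fixed A ϖ k) : reduce ϖ k (Quotient.out x) = x :=
  Quotient.out_eq x

theorem reduce_surjective : Function.Surjective (reduce ϖ k) := Ideal.Quotient.mk_surjective

variable [IsDomain A]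

/-- Since `c < k`, the valuation of the divisor does not depend on its lift, and divisibility in the
quotient ring suffices to avoid an error. -/
theorem fixedDiv_ensures (hϖ : ¬ IsUnit ϖ) (hϖ0 : ϖ ≠ 0) {c : ℕ} (hc : c < k) {v : A}
    (hv : IsUnit v) {x y : Fixed A ϖ k} (hy : y = reduce ϖ k (ϖ ^ c * v)) (hx : y ∣ x) :
    (fixedDiv x y).Ensures fun z => x = y * z ∧ (x = 0 → z = 0) := by
  have hndvd : ∀ r, ¬ ϖ ^ (c + 1) ∣ ϖ ^ c * v + ϖ ^ k * r := by
    intro r h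
    have h1 : ϖ ^ (c + 1) ∣ ϖ ^ c * v :=
      (dvd_add_left ((pow_dvd_pow ϖ (by omega)).mul_right r)).1 h
    rw [pow_succ, mul_dvd_mul_iff_left (pow_ne_zero c hϖ0)] at h1
    exact hϖ (isUnit_of_dvd_unit h1 hv)
  have hyout : ∃ r, Quotient.out y = ϖ ^ c * v + ϖ ^ k * r := by
    have := (reduce_out y).trans hy
    rw [reduce_eq_iff] at this
    obtain ⟨r, hr⟩ := this
    exact ⟨r, by linear_combination hr⟩
  have hy0 : y ≠ 0 := by
    intro h0
    rw [hy, ← map_zero (reduce ϖ k), reduce_eq_iff, sub_zero] at h0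
    obtain ⟨r, hr⟩ := h0
    refine hndvd (-r) ?_
    rw [hr]; simp
  have hyval : fixedVal y ≤ c := by
    rw [fixedVal, if_neg hy0]
    obtain ⟨r, hr⟩ := hyout
    rw [hr, ← not_lt]
    intro h
    refine hndvd r (pow_dvd_of_le_emultiplicity ?_)
    have := Order.add_one_le_of_lt h
    exact_mod_cast this
  have hxval : (c : ℕ∞) ≤ fixedVal x := by
    rw [fixedVal]
    split_ifs with h0
    · exact_mod_cast hc.le
    · obtain ⟨w, hw⟩ := hx
      obtain ⟨w, rfl⟩ := reduce_surjective w
      have := (reduce_out x).trans hw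
      rw [hy, ← map_mul, reduce_eq_iff] at this
      obtain ⟨r, hr⟩ := this
      apply le_emultiplicity_of_pow_dvd
      have h1 : Quotient.out x = ϖ ^ c * v * w + ϖ ^ k * r := by linear_combination hr
      rw [h1]
      exact dvd_add (Dvd.intro _ (mul_assoc _ _ _).symm) ((pow_dvd_pow ϖ hc.le).mul_right r)
  rw [fixedDiv, if_neg (not_lt.2 (hyval.trans hxval))]
  split_ifs with h0
  · refine ⟨fun h => Option.some_ne_none _ h.symm, ⟨0, rfl⟩, fun z hz => ?_⟩
    obtain rfl : z = 0 := Option.some.inj hz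
    exact ⟨by rw [h0, mul_zero], fun _ => rfl⟩
  · exact Run.ensures_choose hx fun z hz => ⟨hz, fun h => absurd h h0⟩

theorem fixedDiv_two_pow_ensures (hϖ : ¬ IsUnit ϖ) (hϖ0 : ϖ ≠ 0)
    (he : Associated (2 : A) (ϖ ^ e)) {i : ℕ} (hi : e * i < k) {v : A}
    (hv : IsUnit v) {x y : Fixed A ϖ k} (hy : y = reduce ϖ k (2 ^ i * v)) (hx : y ∣ x) :
    (fixedDiv x y).Ensures fun z => x = y * z ∧ (x = 0 → z = 0) := by
  obtain ⟨ε, hε⟩ := he.symm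
  refine fixedDiv_ensures hϖ hϖ0 hi (v := ε ^ i * v) ((ε.isUnit.pow i).mul hv) ?_ hx
  rw [hy, ← hε]; ring_nf

theorem divCoeffs_ensures (hϖ : ¬ IsUnit ϖ) (hϖ0 : ϖ ≠ 0)
    (he : Associated (2 : A) (ϖ ^ e)) (hk : e < k) {f : (Fixed A ϖ k)⟦X⟧} (n : ℕ)
    (hf : ∀ i < n, 2 ∣ coeff i f) :
    (divCoeffs f 2 n).Ensures fun g => ∀ i,
      (i < n → coeff i f = 2 * coeff i g ∧ (coeff i f = 0 → coeff i g = 0)) ∧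
        (n ≤ i → coeff i g = 0) := by
  induction n with
  | zero => exact Run.ensures_pure (by simp)
  | succ n ih =>
    refine (ih fun i hi => hf i (by omega)).bind fun g hg => ?_
    refine (fixedDiv_two_pow_ensures hϖ hϖ0 he (i := 1) (by omega) isUnit_one
      (by rw [pow_one, mul_one, map_ofNat])
      (hf n (by omega))).bind fun c hc => Run.ensures_pure fun i => ?_
    rw [map_add, coeff_monomial]
    rcases lt_trichotomy i n with hi | rfl | hi
    · rw [if_neg hi.ne, add_zero]
      exact ⟨fun _ => (hg i).1 hi, fun h => absurd h (by omega)⟩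
    · rw [if_pos rfl, (hg i).2 le_rfl, zero_add]
      exact ⟨fun _ => hc, fun h => absurd h (by omega)⟩
    · rw [if_neg hi.ne', add_zero]
      exact ⟨fun h => absurd h (by omega), fun _ => (hg i).2 hi.le⟩

/-- The solver of the linearized equation does not fail on a right hand side which is close to
`linOp a ys` for an integral `ys`, and it solves the equation exactly at the working precision. -/
theorem linDiffSolve_ensures [CharZero A] (hϖ : ¬ IsUnit ϖ) (hϖ0 : ϖ ≠ 0)
    (he : Associated (2 : A) (ϖ ^ e)) (hk : e < k) (h2 : ∀ x : A, IsUnit (1 + 2 * x)) {a : A}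
    (ha : IsUnit a) {ν : A} (hν : 2 ∣ ν) {ℓ : ℕ} (hκ : 2 * (2 ^ ℓ * ν) ∣ ϖ ^ k)
    {f : (Fixed A ϖ k)⟦X⟧} {ys : A⟦X⟧} {m : ℕ} (n : ℕ) (hn : ∀ i < n, binWeight i ≤ ℓ)
    (hf : ∀ i < n, ∃ φ, 2 * (2 ^ ℓ * ν) ∣ φ ∧
      coeff i f = reduce ϖ k (coeff i (linOp a ys) + φ))
    (hf0 : ∀ i < m, coeff i f = 0) :
    (linDiffSolve (reduce ϖ k a) f n).Ensures fun y =>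
      (∀ i < n, coeff i (linOp (reduce ϖ k a) y) = coeff i f) ∧
      (∀ i < n, ∃ d, coeff i y = reduce ϖ k (coeff i ys + d) ∧
        2 ^ ℓ * ν ∣ 2 ^ binWeight i * d) ∧
      (∀ i < m, coeff i y = 0) ∧ ∀ i, n ≤ i → coeff i y = 0 := by
  induction n with
  | zero => exact Run.ensures_pure (by simp)
  | succ i ih =>
    refine (ih (fun j hj => hn j (by omega)) fun j hj => hf j (by omega)).bind
      fun y ⟨hlin, hclose, hym, hyn⟩ => ?_
    obtain ⟨φ, hφ, hfi⟩ := hf i (by omega)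
    obtain ⟨d, hd1, hd2⟩ : ∃ d, (i : Fixed A ϖ k) * coeff (i - 1) y =
        reduce ϖ k (i * (coeff (i - 1) ys + d)) ∧
        (i ≠ 0 → 2 ^ ℓ * ν ∣ 2 ^ binWeight (i - 1) * d) := by
      rcases Nat.eq_zero_or_pos i with rfl | hi
      · exact ⟨0, by simp, by simp⟩
      · obtain ⟨d, hd1, hd2⟩ := hclose (i - 1) (by omega)
        exact ⟨d, by rw [hd1, map_mul, map_natCast], fun _ => hd2⟩
    -- The error `d` inherited from the previous coefficient is still even: this is where `2 ∣ ν` is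
    -- used, and why the dividend stays divisible by `2`.
    have hid : (2 : A) ∣ i * d := by
      rcases Nat.eq_zero_or_pos i with rfl | hi
      · simp
      · exact (hν.trans (dvd_of_two_pow_binWeight_mul (hn (i - 1) (by omega))
          (hd2 (by omega)))).mul_left _
    have hnum : (i : Fixed A ϖ k) * coeff (i - 1) y - coeff i f =
        reduce ϖ k (2 * a * (2 * i + 1) * coeff i ys + (i * d - φ)) := by
      rw [hd1, hfi, ← map_sub, coeff_linOp]; congr 1; ring
    have hu : IsUnit (a * (2 * (i : A) + 1)) := by
      rw [add_comm]; exact ha.mul (h2 i)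
    have hden : 2 * reduce ϖ k a * (2 * (i : Fixed A ϖ k) + 1) =
        reduce ϖ k (2 * a * (2 * i + 1)) := by
      simp only [map_mul, map_add, map_one, map_natCast, map_ofNat]
    have hdvd : 2 * reduce ϖ k a * (2 * (i : Fixed A ϖ k) + 1) ∣
        (i : Fixed A ϖ k) * coeff (i - 1) y - coeff i f := by
      rw [hden, hnum]
      refine map_dvd _ (dvd_add (dvd_mul_right _ _) ?_)
      rw [mul_assoc, mul_comm, hu.mul_left_dvd]
      exact dvd_sub hid (dvd_of_mul_right_dvd hφ)
    refine (fixedDiv_two_pow_ensures hϖ hϖ0 he (i := 1) (by omega) hu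
      (by rw [hden]; ring_nf) hdvd).bind fun c ⟨hc, hc0⟩ => Run.ensures_pure ?_
    have hlt : ∀ j, j < i → coeff j (y + monomial i c) = coeff j y := fun j hj => by
      rw [map_add, coeff_monomial, if_neg hj.ne, add_zero]
    have heq : coeff i (y + monomial i c) = c := by
      rw [map_add, coeff_monomial, if_pos rfl, hyn i le_rfl, zero_add]
    have hpred : (i : Fixed A ϖ k) * coeff (i - 1) (y + monomial i c) =
        (i : Fixed A ϖ k) * coeff (i - 1) y := by
      rcases Nat.eq_zero_or_pos i with rfl | hi
      · simp
      · rw [hlt _ (by omega)]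
    refine ⟨fun j hj => ?_, fun j hj => ?_, fun j hj => ?_, fun j hj => ?_⟩
    · rcases Nat.lt_succ_iff_lt_or_eq.1 hj with hji | rfl
      · rw [← hlin j hji, coeff_linOp, coeff_linOp, hlt _ hji, hlt _ (by omega)]
      · rw [coeff_linOp, heq, hpred]
        linear_combination hc
    · rcases Nat.lt_succ_iff_lt_or_eq.1 hj with hji | rfl
      · rw [hlt _ hji]; exact hclose j hji
      · obtain ⟨c, rfl⟩ := reduce_surjective c
        rw [heq]
        refine ⟨c - coeff j ys, by rw [add_sub_cancel], ?_⟩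
        -- The arbitrary choice made by the division only adds a multiple of `ϖ ^ k` to `φ`, which
        -- `hκ` absorbs.
        rw [hnum, hden, ← map_mul, reduce_eq_iff] at hc
        obtain ⟨r, hr⟩ := hc
        exact dvd_two_pow_binWeight_mul h2 ha (e := d) (φ := φ + ϖ ^ k * r)
          (by linear_combination -hr) hd2 (dvd_add hφ (hκ.mul_right r))
    · rcases lt_trichotomy j i with hji | rfl | hji
      · rw [hlt _ hji]; exact hym j hj
      · rw [heq]
        -- Here the convention that `0` divided by anything admissible is exactly `0` is essential:
        -- it keeps `y` a multiple of `t ^ m`.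
        refine hc0 ?_
        rw [hf0 j hj, sub_zero, hym (j - 1) (by omega), mul_zero]
      · rw [map_add, coeff_monomial, if_neg hji.ne', hyn j hji.le, zero_add]
    · rw [map_add, coeff_monomial, if_neg (by omega), hyn j (by omega), zero_add]

end Division

/-! ### Newton steps for the equation and for the inverse of `z'²` -/

section NewtonStep

open PowerSeries

variable {R : Type*} [CommRing R]

theorem X_pow_dvd_derivative {n : ℕ} {f : R⟦X⟧} (h : X ^ (n + 1) ∣ f) :
    X ^ n ∣ derivative R f :=
  X_pow_dvd_iff.2 fun i hi => by
    rw [coeff_derivative, X_pow_dvd_iff.1 h (i + 1) (by omega), zero_mul]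

theorem X_pow_dvd_linOp {a : R} {m : ℕ} {y : R⟦X⟧} (hy : X ^ m ∣ y) : X ^ m ∣ linOp a y := by
  have : linOp a y = (X - 4 * C a) * (X * derivative R y) + (X - 2 * C a) * y := by
    rw [linOp]; ring
  rw [this]
  exact dvd_add ((mem_coeffIdeal_zero.1 (X_mul_derivative_mem_coeffIdeal
    (mem_coeffIdeal_zero.2 hy))).mul_left _) (hy.mul_left _)

theorem X_pow_dvd_dSeries_sub {l a : R} {m : ℕ} {x y : R⟦X⟧} (h : X ^ m ∣ y - x) :
    X ^ m ∣ dSeries l a y - dSeries l a x := by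
  have : dSeries l a y - dSeries l a x = dSeries 0 a (y - x) := by
    rw [← add_sub_cancel x y, dSeries_add]; simp
  rw [this]
  exact mem_coeffIdeal_zero.1 (dSeries_mem_coeffIdeal (mem_coeffIdeal_zero.2 h))

theorem X_pow_dvd_mul_of_le {m n : ℕ} (hn : n ≤ 2 * m) {f g : R⟦X⟧} (hf : X ^ m ∣ f)
    (hg : X ^ m ∣ g) : X ^ n ∣ f * g :=
  (pow_dvd_pow X hn).trans (by rw [two_mul, pow_add]; exact mul_dvd_mul hf hg)

/-- Multiplying by approximate inverses of `u³` and `z²`. -/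
theorem X_pow_dvd_mul_inverse_sub {m n : ℕ} (hn : n ≤ 2 * m) {g u3 z2 r i : R⟦X⟧}
    (hg : X ^ m ∣ g) (hr : X ^ m ∣ r * z2 - 1) (hi : X ^ m ∣ i * u3 - 1) :
    X ^ n ∣ u3 * z2 * g * (r * i) - g := by
  have : u3 * z2 * g * (r * i) - g = g * ((r * z2 - 1) * (i * u3) + (i * u3 - 1)) := by ring
  rw [this]
  exact X_pow_dvd_mul_of_le hn hg (dvd_add (hr.mul_right _) hi)

/-- Inverses of `z'²` and `u³` modulo `t ^ m` are enough, because they multiply `h`, itself a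
multiple of `t ^ m`. -/
theorem newton_step {l a : R} {u : R⟦X⟧} {w : Polynomial R} {m n : ℕ} (hn : n ≤ 2 * m)
    {x y h r i : R⟦X⟧} (hx : X ^ m ∣ defect l a u w x) (hy : X ^ m ∣ y) (hh : X ^ m ∣ h)
    (hxh : X ^ n ∣ 2 * h - defect l a u w x) (hr : X ^ m ∣ r * dSeries l a x ^ 2 - 1)
    (hi : X ^ m ∣ i * u ^ 3 - 1) (hL : X ^ n ∣ linOp a y - h * r * i) :
    X ^ n ∣ defect l a u w (x + dSeries l a x * u * y) := by
  have h1 := (pow_dvd_pow X hn).trans (newton_defect l a u w hx hy)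
  have h2 := X_pow_dvd_mul_inverse_sub hn hh hr hi
  have e : defect l a u w (x + dSeries l a x * u * y) =
      (defect l a u w (x + dSeries l a x * u * y) -
        (defect l a u w x - 2 * u ^ 3 * dSeries l a x ^ 2 * linOp a y)) -
      (2 * h - defect l a u w x) -
      2 * (u ^ 3 * dSeries l a x ^ 2 * h * (r * i) - h) -
      2 * u ^ 3 * dSeries l a x ^ 2 * (linOp a y - h * r * i) := by ring
  rw [e]
  exact dvd_sub (dvd_sub (dvd_sub h1 hxh) (h2.mul_left _)) (hL.mul_left _)

/-- The factor `2` cannot be cancelled in the quotient ring: halving the defect costs one digit on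
the right hand side of the linear equation. -/
theorem newton_rhs {l a : R} {u : R⟦X⟧} {w : Polynomial R} {m n : ℕ} (hn : n ≤ 2 * m)
    {x y h r i : R⟦X⟧} (hy : X ^ m ∣ y)
    (hxy : X ^ n ∣ defect l a u w x - 2 * u ^ 3 * dSeries l a x ^ 2 * linOp a y)
    (hxh : X ^ n ∣ 2 * h - defect l a u w x) (hr : X ^ m ∣ r * dSeries l a x ^ 2 - 1)
    (hi : X ^ m ∣ i * u ^ 3 - 1) :
    X ^ n ∣ 2 * (h * r * i - linOp a y) := by
  have h2 := X_pow_dvd_mul_inverse_sub hn (X_pow_dvd_linOp (a := a) hy) hr hi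
  have e : 2 * (h * r * i - linOp a y) =
      (2 * h - defect l a u w x) * (r * i) +
      (defect l a u w x - 2 * u ^ 3 * dSeries l a x ^ 2 * linOp a y) * (r * i) +
      2 * (u ^ 3 * dSeries l a x ^ 2 * linOp a y * (r * i) - linOp a y) := by ring
  rw [e]
  exact dvd_add (dvd_add (hxh.mul_right _) (hxy.mul_right _)) (h2.mul_left _)

theorem inverse_step {m m' : ℕ} (hm : m ≤ 2 * m') {r z2 w : R⟦X⟧} (hr : X ^ m' ∣ r * z2 - 1)
    (hw : X ^ m ∣ w - z2) : X ^ m ∣ r * (2 - r * w) * z2 - 1 := by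
  have e : r * (2 - r * w) * z2 - 1 = -((r * z2 - 1) * (r * z2 - 1)) - r ^ 2 * z2 * (w - z2) := by
    ring
  rw [e]
  exact dvd_sub ((X_pow_dvd_mul_of_le hm hr hr).neg_right) (hw.mul_left _)

theorem X_pow_dvd_aeval_trunc_sub {ζ : R⟦X⟧} (hζ : X ∣ ζ) (w : Polynomial R) (n : ℕ) :
    X ^ n ∣ Polynomial.aeval ζ (trunc n (w : R⟦X⟧)) - Polynomial.aeval ζ w := by
  have h : Polynomial.X ^ n ∣ trunc n (w : R⟦X⟧) - w := by
    rw [Polynomial.X_pow_dvd_iff]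
    intro i hi
    rw [Polynomial.coeff_sub, coeff_trunc, if_pos hi, Polynomial.coeff_coe, sub_self]
  obtain ⟨s, hs⟩ := h
  rw [← map_sub, hs, map_mul, map_pow, Polynomial.aeval_X]
  exact (pow_dvd_pow_of_dvd hζ n).mul_right _

theorem X_dvd_seriesOfQ (l a : R) (x : R⟦X⟧) : X ∣ seriesOfQ l a x := by
  rw [seriesOfQ, mul_assoc X]
  exact dvd_add (dvd_mul_left _ _) (dvd_mul_right _ _)

theorem X_pow_dvd_composeW_sub (l a : R) (w : Polynomial R) (x : R⟦X⟧) (n : ℕ) :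
    X ^ n ∣ composeW l a (w : R⟦X⟧) x n - wVal w X (C l) (C a) x := by
  have h1 := X_pow_dvd_truncT_sub n ((C l + (X - C (4 * a)) * x) * (C l + X * x) *
    Polynomial.aeval (seriesOfQ l a x) (trunc n (w : R⟦X⟧)))
  have h2 := X_pow_dvd_aeval_trunc_sub (X_dvd_seriesOfQ l a x) w n
  have h3 : wVal w X (C l) (C a) x =
      (C l + (X - C (4 * a)) * x) * (C l + X * x) * Polynomial.aeval (seriesOfQ l a x) w := by
    rw [wVal, seriesOfQ_eq, map_mul, map_ofNat]
  rw [h3, composeW]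
  have := dvd_add h1 (h2.mul_left ((C l + (X - C (4 * a)) * x) * (C l + X * x)))
  convert this using 1
  ring

end NewtonStep

/-! ### Correctness of `diffSolve` at the working precision -/

section DiffSolve

open PowerSeries

variable {A : Type*} [CommRing A]

/-- The working precision `ϖ ^ k` is `2 ^ (ℓ + 2) ν`, where `8` divides `ν`. -/
structure IsPrecision (ϖ : A) (k e ℓ : ℕ) (ν : A) : Prop where
  not_isUnit : ¬ IsUnit ϖ
  ne_zero : ϖ ≠ 0
  two : Associated (2 : A) (ϖ ^ e)
  lt : 2 * e < k
  isUnit_one_add_two_mul : ∀ x : A, IsUnit (1 + 2 * x)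
  associated : Associated (ϖ ^ k) (2 ^ (ℓ + 2) * (8 * ν))

/-- The precomputed data are correct at the precision that `diffSolve` needs up to order `n`. -/
structure IsSolverData {ϖ : A} {k : ℕ} (D : SolverData (Fixed A ϖ k)) (l a : A) (u : A⟦X⟧)
    (w : Polynomial A) (n : ℕ) : Prop where
  a_eq : D.a = reduce ϖ k a
  b_eq : D.b = reduce ϖ k (l * a)
  u_sub : X ^ ((n + 1) / 2) ∣ D.u - PowerSeries.map (reduce ϖ k) u
  u2_sub : X ^ n ∣ D.u2 - PowerSeries.map (reduce ϖ k) u ^ 2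
  uInv3_mul : X ^ ((n + 1) / 2) ∣ D.uInv3 * PowerSeries.map (reduce ϖ k) u ^ 3 - 1
  v2_eq : D.v2 = (w.map (reduce ϖ k) : Polynomial (Fixed A ϖ k))

variable {ϖ : A} {k e ℓ : ℕ} {ν : A}

theorem X_pow_dvd_map_defect_iff {l a : A} {u : A⟦X⟧} {w : Polynomial A} {m : ℕ} {x : A⟦X⟧} :
    X ^ m ∣ defect (reduce ϖ k l) (reduce ϖ k a) (PowerSeries.map (reduce ϖ k) u)
      (w.map (reduce ϖ k)) (PowerSeries.map (reduce ϖ k) x) ↔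
    defect l a u w x ∈ coeffIdeal (ϖ ^ k) m := by
  rw [← map_defect, X_pow_dvd_map_mk_iff]

theorem coeffIdeal_eq_of_associated {c d : A} (h : Associated c d) (m : ℕ) :
    coeffIdeal c m = coeffIdeal d m := by
  ext f
  exact ⟨coeffIdeal_mono h.symm.dvd le_rfl, coeffIdeal_mono h.dvd le_rfl⟩

variable [IsDomain A]

theorem IsPrecision.fixedDiv_unit_ensures (h : IsPrecision ϖ k e ℓ ν)
    {y x : Fixed A ϖ k} {v : A} (hv : IsUnit v) (hy : y = reduce ϖ k v) :
    (fixedDiv (y * x) y).Ensures fun z => z = x := by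
  refine (fixedDiv_ensures h.not_isUnit h.ne_zero (c := 0) (by have := h.lt; omega) hv
    (by rw [hy, pow_zero, one_mul]) (dvd_mul_right y x)).mono fun z hz => ?_
  have hyu : IsUnit y := by rw [hy]; exact hv.map _
  exact (hyu.mul_left_cancel hz.1).symm

theorem IsPrecision.fixedDiv_l_ensures (h : IsPrecision ϖ k e ℓ ν)
    {D : SolverData (Fixed A ϖ k)} {l a : A} {u : A⟦X⟧} {w : Polynomial A} {n : ℕ}
    (hD : IsSolverData D l a u w n) (ha : IsUnit a) :
    (fixedDiv D.b D.a).Ensures fun z => z = reduce ϖ k l := by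
  have : D.b = D.a * reduce ϖ k l := by rw [hD.a_eq, hD.b_eq, map_mul, mul_comm]
  rw [this]
  exact h.fixedDiv_unit_ensures ha hD.a_eq

/-- What the Newton iteration achieves: an exact solution at the working precision. -/
def IsDiffSolution (ϖ : A) (k : ℕ) (l a : A) (u : A⟦X⟧) (w : Polynomial A) (N : ℕ)
    (x : (Fixed A ϖ k)⟦X⟧ × (Fixed A ϖ k)⟦X⟧) : Prop :=
  X ^ N ∣ defect (reduce ϖ k l) (reduce ϖ k a) (PowerSeries.map (reduce ϖ k) u)
    (w.map (reduce ϖ k)) x.1 ∧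
  X ^ ((N + 1) / 2) ∣ x.2 * dSeries (reduce ϖ k l) (reduce ϖ k a) x.1 ^ 2 - 1

/-- The division by `4a` determines `q_0` only up to two digits, but the constant terms of the
defect and of `z'` involve `q_0` only through `4 a q_0`, so they are exact for every admissible
quotient. -/
theorem diffSolve_one_ensures (h : IsPrecision ϖ k e ℓ ν) {l a : A} {u : A⟦X⟧}
    {w : Polynomial A} {q : A⟦X⟧} {n : ℕ} (hs : IsSolutionMod l a u w q n) (hn : 1 ≤ n)
    {D : SolverData (Fixed A ϖ k)} (hD : IsSolverData D l a u w n) :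
    (diffSolve D 1).Ensures (IsDiffSolution ϖ k l a u w 1) := by
  set ρ := reduce ϖ k with hρ
  have hlw := hs.l_mul_coeff_zero hn
  obtain ⟨z1, hz1⟩ : ∃ z1, z1 = l - 4 * a * constantCoeff q := ⟨_, rfl⟩
  have hz1u : IsUnit z1 := hz1 ▸ hs.isUnit_first
  rw [← hz1] at hlw
  rw [diffSolve, if_neg one_ne_zero, if_pos rfl]
  refine (h.fixedDiv_l_ensures hD hs.isUnit_a).bind ?_
  rintro _ rfl
  have hu2 : constantCoeff D.u2 = ρ (constantCoeff u ^ 2) := by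
    have := X_pow_dvd_iff.1 hD.u2_sub 0 (by omega)
    rw [coeff_zero_eq_constantCoeff, map_sub, sub_eq_zero] at this
    rw [this, map_pow, map_pow, ← coeff_zero_eq_constantCoeff, coeff_map,
      coeff_zero_eq_constantCoeff]
  have hv2 : constantCoeff D.v2 = ρ (w.coeff 0) := by
    rw [hD.v2_eq, ← coeff_zero_eq_constantCoeff, Polynomial.coeff_coe, Polynomial.coeff_map]
  have hdiv1 : D.b * constantCoeff D.v2 = D.a * constantCoeff D.u2 * ρ z1 := by
    rw [hD.a_eq, hD.b_eq, hu2, hv2, ← map_mul, ← map_mul, ← map_mul]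
    congr 1
    linear_combination a * hlw
  rw [hdiv1]
  refine (h.fixedDiv_unit_ensures (hs.isUnit_a.mul (hs.isUnit_u_zero.pow 2))
    (by rw [hD.a_eq, hu2, ← map_mul])).bind ?_
  rintro _ rfl
  have hdiv2 : 4 * D.a ∣ ρ l - ρ z1 := by
    refine ⟨ρ (constantCoeff q), ?_⟩
    rw [hD.a_eq, ← map_sub, hz1, ← map_ofNat ρ 4, ← map_mul, ← map_mul]
    congr 1; ring
  refine (fixedDiv_two_pow_ensures h.not_isUnit h.ne_zero h.two (i := 2)
    (by have := h.lt; omega) hs.isUnit_a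
    (by rw [hD.a_eq, show (2 : A) ^ 2 * a = 4 * a by ring, map_mul, map_ofNat]) hdiv2).bind ?_
  rintro c ⟨hc, -⟩
  have hdiv3 : (1 : Fixed A ϖ k) = ρ z1 ^ 2 * ρ (↑(hz1u.unit⁻¹) ^ 2) := by
    rw [← map_pow, ← map_mul, ← mul_pow, hz1u.mul_val_inv, one_pow, map_one]
  have hr := h.fixedDiv_unit_ensures (x := ρ (↑(hz1u.unit⁻¹) ^ 2)) (hz1u.pow 2) (map_pow ρ z1 2)
  rw [map_pow ρ z1 2, ← hdiv3] at hr
  refine hr.bind ?_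
  rintro _ rfl
  refine Run.ensures_pure ⟨?_, ?_⟩
  · have hz : ρ l - 4 * ρ a * c = ρ z1 := by rw [hD.a_eq] at hc; linear_combination hc
    rw [X_pow_dvd_iff]
    intro i hi
    obtain rfl : i = 0 := by omega
    rw [coeff_zero_eq_constantCoeff, constantCoeff_defect]
    simp only [constantCoeff_C, Polynomial.coeff_map]
    rw [← hρ, hz]
    have h1 := congrArg ρ hlw
    simp only [map_mul, map_pow] at h1
    have h2 : constantCoeff (PowerSeries.map ρ u) = ρ (constantCoeff u) := by
      rw [← coeff_zero_eq_constantCoeff, coeff_map, coeff_zero_eq_constantCoeff]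
    rw [h2]
    linear_combination ρ z1 * h1
  · have hz : ρ l - 4 * ρ a * c = ρ z1 := by rw [hD.a_eq] at hc; linear_combination hc
    rw [X_pow_dvd_iff]
    intro i hi
    obtain rfl : i = 0 := by omega
    dsimp only
    rw [coeff_zero_eq_constantCoeff, map_sub, map_mul, map_pow constantCoeff,
      constantCoeff_dSeries]
    simp only [constantCoeff_C, map_one]
    rw [← hρ, hz, mul_comm (ρ _), ← hdiv3, sub_self]

variable [CharZero A]

/-- An approximate solution at order `m`, seen as the truncation of one at order `N`. -/
theorem exists_newton_correction (h : IsPrecision ϖ k e ℓ ν) {l a : A} {u : A⟦X⟧}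
    {w : Polynomial A} {q : A⟦X⟧} {n : ℕ} (hs : IsSolutionMod l a u w q n)
    (hℓ : ∀ i < n, binWeight i ≤ ℓ) {m N : ℕ} (hm : 1 ≤ m) (hmN : m ≤ N) (hN2 : N ≤ 2 * m)
    (hN : N ≤ n) {x : (Fixed A ϖ k)⟦X⟧}
    (hx : X ^ m ∣ defect (reduce ϖ k l) (reduce ϖ k a) (PowerSeries.map (reduce ϖ k) u)
      (w.map (reduce ϖ k)) x) :
    ∃ y : A⟦X⟧, X ^ m ∣ y ∧
      X ^ N ∣ defect (reduce ϖ k l) (reduce ϖ k a) (PowerSeries.map (reduce ϖ k) u)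
        (w.map (reduce ϖ k)) x - 2 * PowerSeries.map (reduce ϖ k) u ^ 3 *
          dSeries (reduce ϖ k l) (reduce ϖ k a) x ^ 2 *
            linOp (reduce ϖ k a) (PowerSeries.map (reduce ϖ k) y) := by
  have h2 := h.isUnit_one_add_two_mul
  obtain ⟨x, rfl⟩ := PowerSeries.map_surjective (reduce ϖ k) reduce_surjective x
  have hx' := X_pow_dvd_map_defect_iff.1 hx
  rw [coeffIdeal_eq_of_associated h.associated] at hx'
  -- The correction sought is `(x' - x) / (z' u)`: a Newton step with it leads exactly to `x'`,
  -- whose defect vanishes modulo `t ^ N`.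
  obtain ⟨x', hxx', hx'd⟩ := hs.exists_extension h2 hℓ hm x hx' hmN hN
  rw [← coeffIdeal_eq_of_associated h.associated] at hx'd
  have hzu : IsUnit (dSeries l a x) := by
    rw [isUnit_iff_constantCoeff, constantCoeff_dSeries,
      show l - 4 * a * constantCoeff x = (l - 4 * a * constantCoeff q) +
        2 * (2 * a * (constantCoeff q - constantCoeff x)) by ring]
    exact isUnit_add_two_mul h2 hs.isUnit_first _
  obtain ⟨v, hv⟩ := (hzu.mul hs.isUnit_u).exists_right_inv
  refine ⟨(x' - x) * v, hxx'.mul_right _, ?_⟩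
  have hy : X ^ m ∣ PowerSeries.map (reduce ϖ k) ((x' - x) * v) := by
    have := map_dvd (PowerSeries.map (reduce ϖ k)) (hxx'.mul_right v)
    rwa [map_pow, map_X] at this
  have h1 := (pow_dvd_pow X hN2).trans (newton_defect _ _ _ _ hx hy)
  have h3 : PowerSeries.map (reduce ϖ k) x +
      dSeries (reduce ϖ k l) (reduce ϖ k a) (PowerSeries.map (reduce ϖ k) x) *
        PowerSeries.map (reduce ϖ k) u * PowerSeries.map (reduce ϖ k) ((x' - x) * v) =
      PowerSeries.map (reduce ϖ k) x' := by
    rw [← map_dSeries, ← map_mul, ← map_mul, ← map_add]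
    congr 1
    linear_combination (x' - x) * hv
  rw [h3] at h1
  exact (dvd_sub_right (X_pow_dvd_map_defect_iff.2 hx'd)).1 h1

end DiffSolve

section DiffSolve

open PowerSeries

variable {A : Type*} [CommRing A] [IsDomain A] [CharZero A] {ϖ : A} {k e ℓ : ℕ} {ν : A}

theorem X_pow_dvd_truncT_sub_of {R : Type*} [CommRing R] {n : ℕ} {f g : R⟦X⟧}
    (h : X ^ n ∣ f - g) : X ^ n ∣ truncT n f - g := by
  rw [← sub_add_sub_cancel (truncT n f) f g]
  exact dvd_add (X_pow_dvd_truncT_sub n f) h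

theorem X_pow_dvd_mul_sub_mul {R : Type*} [CommRing R] {n : ℕ} {f g f' g' : R⟦X⟧}
    (h : X ^ n ∣ f - f') (h' : X ^ n ∣ g - g') : X ^ n ∣ f * g - f' * g' := by
  have e : f * g - f' * g' = (f - f') * g + f' * (g - g') := by ring
  rw [e]
  exact dvd_add (h.mul_right _) (h'.mul_left _)

/-- The invariant is exact vanishing in the quotient ring, so no error is carried through the
recursion. The series `ys` only serves to show that the divisions succeed; the computed `y` need not
reduce to it. -/
theorem diffSolve_ensures (h : IsPrecision ϖ k e ℓ ν) {l a : A} {u : A⟦X⟧}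
    {w : Polynomial A} {q : A⟦X⟧} {n : ℕ} (hs : IsSolutionMod l a u w q n)
    (hℓ : ∀ i < n, binWeight i ≤ ℓ) {D : SolverData (Fixed A ϖ k)}
    (hD : IsSolverData D l a u w n) (N : ℕ) (hN : N ≤ n) :
    (diffSolve D N).Ensures (IsDiffSolution ϖ k l a u w N) := by
  induction N using Nat.strong_induction_on with
  | _ N ih =>
  rcases lt_trichotomy N 1 with hN1 | rfl | hN1
  · obtain rfl : N = 0 := by omega
    rw [diffSolve, if_pos rfl]
    exact Run.ensures_pure ⟨by simp, by simp⟩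
  · exact diffSolve_one_ensures h hs hN hD
  have h2 := h.isUnit_one_add_two_mul
  obtain ⟨m, hm⟩ : ∃ m, m = (N + 1) / 2 := ⟨_, rfl⟩
  have hm1 : 1 ≤ m := by omega
  have hmN : m < N := by omega
  have hN2 : N ≤ 2 * m := by omega
  have hmn : m ≤ (n + 1) / 2 := by omega
  rw [diffSolve, if_neg (by omega), if_neg (by omega), ← hm]
  refine (ih m hmN (by omega)).bind ?_
  rintro ⟨x, r⟩ ⟨hx, hr⟩
  dsimp only at hx hr ⊢
  refine (h.fixedDiv_l_ensures hD hs.isUnit_a).bind ?_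
  rintro _ rfl
  rw [hD.a_eq, hD.v2_eq]
  set ρ := reduce ϖ k with hρ
  set u' := PowerSeries.map ρ u with hu'
  set w' := w.map ρ with hw'
  set z := dSeries (ρ l) (ρ a) x with hz
  set dz := derivative (Fixed A ϖ k) (truncT (N + 1) (seriesOfQ (ρ l) (ρ a) x)) with hdz
  have hdz' : X ^ N ∣ dz - z := by
    rw [hdz, hz, dSeries, ← map_sub]
    exact X_pow_dvd_derivative (X_pow_dvd_truncT_sub _ _)
  set wn := truncT N (dz ^ 2) with hwn
  have hwn' : X ^ N ∣ wn - z ^ 2 :=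
    X_pow_dvd_truncT_sub_of (hdz'.trans (sub_dvd_pow_sub_pow dz z 2))
  set s := truncT N (composeW (ρ l) (ρ a) (w' : (Fixed A ϖ k)⟦X⟧) x N - D.u2 * wn) with hsdef
  have hs' : X ^ N ∣ s - defect (ρ l) (ρ a) u' w' x := by
    refine X_pow_dvd_truncT_sub_of ?_
    rw [defect, sub_sub_sub_comm]
    exact dvd_sub (X_pow_dvd_composeW_sub _ _ _ _ _)
      (X_pow_dvd_mul_sub_mul ((pow_dvd_pow X hN).trans hD.u2_sub) hwn')
  set rn := truncT m (r * (2 - r * wn)) with hrn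
  have hrn' : X ^ m ∣ rn * z ^ 2 - 1 := by
    have h1 : X ^ m ∣ r * (2 - r * wn) * z ^ 2 - 1 :=
      inverse_step (by omega) hr ((pow_dvd_pow X hmN.le).trans hwn')
    have h3 := (X_pow_dvd_truncT_sub m (r * (2 - r * wn))).mul_right (z ^ 2)
    rw [← hrn] at h3
    have := dvd_add h3 h1
    rwa [sub_mul, add_comm, sub_add_sub_cancel'] at this
  have hi : X ^ m ∣ D.uInv3 * u' ^ 3 - 1 := (pow_dvd_pow X hmn).trans hD.uInv3_mul
  obtain ⟨ys, hys, hsys⟩ := exists_newton_correction h hs hℓ hm1 hmN.le hN2 hN hx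
  have hys' : X ^ m ∣ PowerSeries.map ρ ys := by
    have := map_dvd (PowerSeries.map ρ) hys
    rwa [map_pow, map_X] at this
  have hseven : ∀ i < N, 2 ∣ coeff i s := by
    intro i hi
    have h3 := X_pow_dvd_iff.1 (dvd_add hs' hsys) i hi
    rw [sub_add_sub_cancel, map_sub, sub_eq_zero] at h3
    refine ⟨coeff i (u' ^ 3 * z ^ 2 * linOp (ρ a) (PowerSeries.map ρ ys)), ?_⟩
    rw [h3, ← coeff_C_mul, map_ofNat]
    congr 1; ring
  refine (divCoeffs_ensures h.not_isUnit h.ne_zero h.two (by have := h.lt; omega) N hseven).bind ?_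
  intro g hg
  have hgs : X ^ N ∣ 2 * g - s := by
    rw [X_pow_dvd_iff]
    intro i hi
    rw [map_sub, ← map_ofNat C 2, coeff_C_mul, ← ((hg i).1 hi).1, sub_self]
  have hgd : X ^ N ∣ 2 * g - defect (ρ l) (ρ a) u' w' x := by
    rw [← sub_add_sub_cancel (2 * g) s]
    exact dvd_add hgs hs'
  -- Vanishing coefficients of `s` are halved to exactly `0`; other halves would destroy the
  -- quadratic convergence.
  have hgm : X ^ m ∣ g := by
    rw [X_pow_dvd_iff]
    intro i hi
    refine ((hg i).1 (by omega)).2 ?_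
    have h3 := X_pow_dvd_iff.1 hs' i (by omega)
    rw [map_sub, sub_eq_zero] at h3
    rw [h3]
    exact X_pow_dvd_iff.1 hx i hi
  set f := truncT N (g * rn * D.uInv3) with hf
  have hf' : X ^ N ∣ f - g * rn * D.uInv3 := X_pow_dvd_truncT_sub _ _
  have hfm : ∀ i < m, coeff i f = 0 := by
    intro i hi
    rw [hf, coeff_truncT, if_pos (by omega)]
    exact X_pow_dvd_iff.1 ((hgm.mul_right rn).mul_right D.uInv3) i hi
  have hrhs := newton_rhs hN2 hys' hsys hgd hrn' hi
  have hfclose : ∀ i < N, ∃ φ, 2 * (2 ^ ℓ * (8 * ν)) ∣ φ ∧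
      coeff i f = ρ (coeff i (linOp a ys) + φ) := by
    intro i hi
    obtain ⟨fi, hfi⟩ := reduce_surjective (coeff i f)
    refine ⟨fi - coeff i (linOp a ys), ?_, by rw [add_sub_cancel, hfi]⟩
    have h3 := X_pow_dvd_iff.1 hrhs i hi
    have h4 := X_pow_dvd_iff.1 hf' i hi
    rw [map_sub, sub_eq_zero] at h4
    rw [← map_ofNat C 2, coeff_C_mul, map_sub, ← h4, ← hfi, ← map_linOp, coeff_map,
      ← map_ofNat ρ 2, ← map_sub, ← map_mul, Ideal.Quotient.eq_zero_iff_mem,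
      Ideal.mem_span_singleton] at h3
    -- Back in `A`, one `2` is cancelled, leaving the precision `2 * (2 ^ ℓ * (8 * ν))` required by
    -- `linDiffSolve_ensures`.
    have h5 := h.associated.symm.dvd.trans h3
    rw [show (2 : A) ^ (ℓ + 2) * (8 * ν) = 2 * (2 * (2 ^ ℓ * (8 * ν))) by ring] at h5
    exact (mul_dvd_mul_iff_left two_ne_zero).1 h5
  refine (linDiffSolve_ensures h.not_isUnit h.ne_zero h.two (by have := h.lt; omega) h2
    hs.isUnit_a (ν := 8 * ν) ⟨4 * ν, by ring⟩ ?_ N (fun i hi => hℓ i (by omega)) hfclose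
    hfm).bind ?_
  · refine dvd_trans ⟨2, ?_⟩ h.associated.symm.dvd
    ring
  rintro y ⟨hylin, -, hym, -⟩
  have hym' : X ^ m ∣ y := X_pow_dvd_iff.2 hym
  have hL : X ^ N ∣ linOp (ρ a) y - g * rn * D.uInv3 := by
    rw [← sub_add_sub_cancel _ f]
    refine dvd_add (X_pow_dvd_iff.2 fun i hi => ?_) hf'
    rw [map_sub, hylin i hi, sub_self]
  have hnew := newton_step hN2 hx hym' hgm hgd hrn' hi hL
  have hclose : X ^ N ∣ truncT N (x + dz * D.u * y) - (x + z * u' * y) := by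
    -- Knowing `u` modulo half the order suffices, since its error is multiplied by `y`, a multiple
    -- of `t ^ m`.
    refine X_pow_dvd_truncT_sub_of ?_
    have e : x + dz * D.u * y - (x + z * u' * y) =
        (dz - z) * (D.u * y) + z * (y * (D.u - u')) := by ring
    rw [e]
    exact dvd_add (hdz'.mul_right _) ((X_pow_dvd_mul_of_le hN2 hym'
      ((pow_dvd_pow X hmn).trans hD.u_sub)).mul_left _)
  refine Run.ensures_pure ⟨?_, ?_⟩
  · exact mem_coeffIdeal_zero.1 (defect_mem_congr (mem_coeffIdeal_zero.2 hclose)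
      (mem_coeffIdeal_zero.2 hnew))
  · rw [← hm]
    have hxm : X ^ m ∣ truncT N (x + dz * D.u * y) - x := by
      have h3 := (pow_dvd_pow X hmN.le).trans hclose
      have h4 : X ^ m ∣ z * u' * y := hym'.mul_left _
      have := dvd_add h3 h4
      rwa [← sub_sub, sub_add_cancel] at this
    have h3 := (X_pow_dvd_dSeries_sub (l := ρ l) (a := ρ a) hxm).trans
      (sub_dvd_pow_sub_pow _ _ 2)
    have := dvd_add (h3.mul_left rn) hrn'
    rwa [mul_sub, sub_add_sub_cancel] at this

end DiffSolve

/-! ### From the differential equation to `q`, and correctness of `isoSolve` -/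

section Solution

open PowerSeries

variable {A : Type*} [CommRing A]

theorem X_pow_dvd_subst_sub_aeval_trunc {z : A⟦X⟧} (hz : constantCoeff z = 0) (f : A⟦X⟧) (n : ℕ) :
    X ^ n ∣ (f.subst z : A⟦X⟧) - Polynomial.aeval z (trunc n f) := by
  have hs : HasSubst z := HasSubst.of_constantCoeff_zero' hz
  have h1 := eq_X_pow_mul_shift_add_trunc n f
  have h2 : (f.subst z : A⟦X⟧) = z ^ n * ((mk fun i => coeff (i + n) f).subst z : A⟦X⟧) +
      Polynomial.aeval z (trunc n f) := by
    conv_lhs => rw [h1]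
    rw [subst_add hs, subst_mul hs, subst_pow hs, subst_X hs, subst_coe hs]
  rw [h2, add_sub_cancel_right]
  exact (pow_dvd_pow_of_dvd (X_dvd_iff.2 hz) n).mul_right _

variable {K : Type*} [Field K] [Algebra A K]

theorem X_sub_C_ne_zero_of_nontrivial [Nontrivial A] (c : A) : (X - C c : A⟦X⟧) ≠ 0 := by
  intro h
  have := congrArg (coeff 1) h
  simp at this

/-- The differential equation, over the ring of integers. -/
theorem integral_equation (hK : Function.Injective (algebraMap A K)) {U V : K⟦X⟧} {a b : A}
    {u v z : A⟦X⟧} (hU : IsFactorization U a u) (hV : IsFactorization V b v)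
    (hz : IsNonzeroSolution U V (PowerSeries.map (algebraMap A K) z)) :
    constantCoeff z = 0 ∧ z ≠ 0 ∧
      X * (X - 4 * C a) * u ^ 2 * derivative A z ^ 2 =
        z * (z - 4 * C b) * ((v ^ 2).subst z : A⟦X⟧) := by
  obtain ⟨h0, hne, heq⟩ := hz
  have hz0 : constantCoeff z = 0 := by
    apply hK
    rw [map_zero, ← h0, ← coeff_zero_eq_constantCoeff, ← coeff_zero_eq_constantCoeff, coeff_map]
  refine ⟨hz0, fun h => hne (by rw [h, map_zero]), ?_⟩
  apply PowerSeries.map_injective (algebraMap A K) hK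
  have hs : HasSubst z := HasSubst.of_constantCoeff_zero' hz0
  have hs' : HasSubst (PowerSeries.map (algebraMap A K) z) := HasSubst.of_constantCoeff_zero' h0
  have hC : ∀ c : K, (C c).subst (PowerSeries.map (algebraMap A K) z) = (C c : K⟦X⟧) := by
    intro c
    have := subst_coe hs' (Polynomial.C c)
    rw [Polynomial.coe_C, Polynomial.aeval_C] at this
    exact this
  have hm : PowerSeries.map (algebraMap A K) ((v ^ 2).subst z : A⟦X⟧) =
      (PowerSeries.map (algebraMap A K) (v ^ 2)).subst (PowerSeries.map (algebraMap A K) z) :=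
    map_subst hs (h := algebraMap A K) (v ^ 2)
  have hsub : ∀ f g : K⟦X⟧, (f - g).subst (PowerSeries.map (algebraMap A K) z) =
      (f.subst (PowerSeries.map (algebraMap A K) z) -
        g.subst (PowerSeries.map (algebraMap A K) z) : K⟦X⟧) := by
    intro f g
    rw [← coe_substAlgHom hs', map_sub]
  rw [hU.2.2, hV.2.2, subst_mul hs', subst_mul hs', subst_X hs', hsub, subst_X hs', hC] at heq
  simp only [map_mul, map_pow, map_sub, map_X, map_C, map_ofNat, hm, map_derivative] at heq ⊢
  exact heq

theorem isSolverData_solverData (ϖ : A) (k n : ℕ) {a b l : A} {u v : A⟦X⟧} (hu : IsUnit u)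
    (hl : b = l * a) (hn : 1 ≤ n) :
    IsSolverData (solverData ϖ k n a u b v) l a u (trunc (n - 1) (v ^ 2)) (n - 1) := by
  have hn2 : (n - 1 + 1) / 2 = n / 2 := by rw [Nat.sub_add_cancel hn]
  refine ⟨rfl, by rw [← hl]; rfl, ?_, ?_, ?_, ?_⟩
  · rw [hn2]; exact X_pow_dvd_truncT_sub _ _
  · rw [← map_pow]; exact X_pow_dvd_truncT_sub _ _
  · rw [hn2]
    have h := (X_pow_dvd_truncT_sub (n / 2) (PowerSeries.map (reduce ϖ k)
      (Ring.inverse (u ^ 3)))).mul_right (PowerSeries.map (reduce ϖ k) u ^ 3)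
    have h1 : PowerSeries.map (reduce ϖ k) (Ring.inverse (u ^ 3)) *
        PowerSeries.map (reduce ϖ k) u ^ 3 = 1 := by
      rw [← map_pow, ← map_mul, Ring.inverse_mul_cancel _ (hu.pow 3), map_one]
    rw [sub_mul, h1] at h
    exact h
  · change truncT (n - 1) (PowerSeries.map (reduce ϖ k) (v ^ 2)) = _
    rw [truncT, trunc_map]

variable [IsDomain A] [CharZero A]

/-- If the coefficient of `t` were zero, the equation divided by `t` would bootstrap the order of
`z` at `0` indefinitely, forcing `z = 0`: the factor `(z - 4b) v²(z)` has a nonzero constant term.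
Otherwise, comparing constant terms gives `a u_0² z_1 = b v_0²`, a unit. -/
theorem isUnit_coeff_one {a b : A} {u v z : A⟦X⟧} (hb : IsUnit b) (hv : IsUnit v) (hz0 : constantCoeff z = 0) (hz : z ≠ 0)
    (heq : X * (X - 4 * C a) * u ^ 2 * derivative A z ^ 2 =
        z * (z - 4 * C b) * ((v ^ 2).subst z : A⟦X⟧)) :
    IsUnit (coeff 1 z) ∧ IsUnit (constantCoeff ((v ^ 2).subst z : A⟦X⟧)) := by
  have h4 : (4 : A) ≠ 0 := mod_cast Nat.cast_ne_zero (R := A).2 (by norm_num : (4 : ℕ) ≠ 0)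
  set G : A⟦X⟧ := (v ^ 2).subst z with hG
  have hG0 : constantCoeff G = constantCoeff v ^ 2 := by
    have h1 := X_pow_dvd_iff.1 (X_pow_dvd_subst_sub_aeval_trunc hz0 (v ^ 2) 1) 0 one_pos
    rw [coeff_zero_eq_constantCoeff, map_sub, sub_eq_zero, constantCoeff_aeval hz0, coeff_trunc,
      if_pos one_pos, coeff_zero_eq_constantCoeff, map_pow] at h1
    exact h1
  have hGu : IsUnit (constantCoeff G) := by
    rw [hG0]; exact (hv.map constantCoeff).pow 2
  refine ⟨?_, hGu⟩
  obtain ⟨g, hg⟩ := X_dvd_iff.2 hz0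
  have hg0 : coeff 1 z = constantCoeff g := by
    rw [hg, show (1 : ℕ) = 0 + 1 from rfl, coeff_succ_X_mul, coeff_zero_eq_constantCoeff]
  have hcancel : (X - 4 * C a) * u ^ 2 * derivative A z ^ 2 = g * ((z - 4 * C b) * G) := by
    refine mul_left_cancel₀ (X_ne_zero (R := A)) ?_
    linear_combination heq + (z - 4 * C b) * G * hg
  have hc0 : constantCoeff ((z - 4 * C b) * G) = -4 * (b * constantCoeff G) := by
    rw [map_mul, map_sub, hz0, map_mul, map_ofNat, constantCoeff_C]; ring
  have hne : constantCoeff ((z - 4 * C b) * G) ≠ 0 := by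
    rw [hc0]
    exact mul_ne_zero (neg_ne_zero.2 h4) (hb.mul hGu).ne_zero
  have hd0 : constantCoeff (derivative A z) = coeff 1 z := by
    rw [← coeff_zero_eq_constantCoeff, coeff_derivative]; simp
  have hg1 : coeff 1 z ≠ 0 := by
    intro h1
    refine hz ?_
    have key : ∀ k, X ^ (k + 2) ∣ z := by
      intro k
      induction k with
      | zero =>
        rw [X_pow_dvd_iff]
        intro i hi
        interval_cases i
        · rw [coeff_zero_eq_constantCoeff, hz0]
        · exact h1
      | succ k ih =>
        have hdz : X ^ (k + 1) ∣ derivative A z := X_pow_dvd_derivative ih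
        have h2 : X ^ (k + 2) ∣ g * ((z - 4 * C b) * G) := by
          rw [← hcancel, pow_two (derivative A z)]
          exact (X_pow_dvd_mul_of_le (by omega) hdz hdz).mul_left _
        have h3 : X ^ (k + 2) ∣ g :=
          (X_prime (R := A)).pow_dvd_of_dvd_mul_right _ (fun h => hne (X_dvd_iff.1 h)) h2
        rw [hg, pow_succ', show k + 1 + 1 = k + 2 from rfl]
        exact mul_dvd_mul_left X h3
    ext i
    rw [map_zero]
    exact X_pow_dvd_iff.1 (key i) i (by omega)
  have h5 := congrArg constantCoeff hcancel
  rw [map_mul constantCoeff g, hc0] at h5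
  simp only [map_mul, map_sub, map_pow, hd0, constantCoeff_X, constantCoeff_C, map_ofNat,
    ← hg0] at h5
  have h6 : a * constantCoeff u ^ 2 * coeff 1 z = b * constantCoeff G := by
    refine mul_left_cancel₀ h4 (mul_left_cancel₀ hg1 ?_)
    linear_combination -h5
  have h7 : IsUnit (a * constantCoeff u ^ 2 * coeff 1 z) := by rw [h6]; exact hb.mul hGu
  exact isUnit_of_mul_isUnit_right h7

/-- The solution is `l t + t (t - 4a) q` for an integral `q`. -/
theorem exists_isSolutionMod {a b : A} {u v z : A⟦X⟧} (ha : IsUnit a) (hb : IsUnit b)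
    (hu : IsUnit u) (hv : IsUnit v) (hz0 : constantCoeff z = 0) (hz : z ≠ 0)
    (heq : X * (X - 4 * C a) * u ^ 2 * derivative A z ^ 2 =
        z * (z - 4 * C b) * ((v ^ 2).subst z : A⟦X⟧)) (n : ℕ) :
    ∃ l q, b = l * a ∧ z = seriesOfQ l a q ∧ IsSolutionMod l a u (trunc n (v ^ 2)) q n := by
  have h4 : (4 : A) ≠ 0 := mod_cast Nat.cast_ne_zero (R := A).2 (by norm_num : (4 : ℕ) ≠ 0)
  obtain ⟨hz1, hG⟩ := isUnit_coeff_one hb hv hz0 hz heq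
  have happrox := X_pow_dvd_subst_sub_aeval_trunc hz0 (v ^ 2) n
  set G : A⟦X⟧ := (v ^ 2).subst z with hGdef
  obtain ⟨g, hg⟩ := X_dvd_iff.2 hz0
  have hgu : IsUnit (g * G) := by
    refine IsUnit.mul (isUnit_iff_constantCoeff.2 ?_) (isUnit_iff_constantCoeff.2 hG)
    rw [hg, show (1 : ℕ) = 0 + 1 from rfl, coeff_succ_X_mul, coeff_zero_eq_constantCoeff] at hz1
    exact hz1
  obtain ⟨i, hi⟩ := hgu.exists_right_inv
  have hcancel : (X - 4 * C a) * u ^ 2 * derivative A z ^ 2 = g * ((z - 4 * C b) * G) := by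
    refine mul_left_cancel₀ (X_ne_zero (R := A)) ?_
    linear_combination heq + (z - 4 * C b) * G * hg
  -- `t - 4a` divides `z - 4b`, since `g * G` is a unit. Writing `H = l + t q` then produces `l = b
  -- / a` and an integral `q`.
  obtain ⟨H, hH⟩ : ∃ H, z - 4 * C b = (X - 4 * C a) * H :=
    ⟨u ^ 2 * derivative A z ^ 2 * i, by linear_combination -(z - 4 * C b) * hi - i * hcancel⟩
  have hl : b = constantCoeff H * a := by
    have := congrArg constantCoeff hH
    simp only [map_sub, map_mul, hz0, constantCoeff_X, constantCoeff_C, map_ofNat] at this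
    exact mul_left_cancel₀ h4 (by linear_combination -this)
  obtain ⟨q, hq⟩ : X ∣ H - C (constantCoeff H) := X_dvd_iff.2 (by simp)
  set l := constantCoeff H with hldef
  have hCb : C b = C l * C a := by rw [hl, map_mul]
  have hH' : H = C l + X * q := by rw [← hq]; ring
  have hzq : z = seriesOfQ l a q := by
    rw [seriesOfQ_eq]
    linear_combination hH + 4 * hCb + (X - 4 * C a) * hH'
  refine ⟨l, q, hl, hzq, ha, hu, ?_, ?_⟩
  · rw [dSeries, ← hzq, isUnit_iff_constantCoeff, ← coeff_zero_eq_constantCoeff, coeff_derivative]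
    simpa using hz1
  · have hT : (X * (X - 4 * C a) : A⟦X⟧) ≠ 0 := by
      rw [← map_ofNat C 4, ← map_mul]
      exact mul_ne_zero X_ne_zero (X_sub_C_ne_zero_of_nontrivial _)
    have hfull : (C l + (X - 4 * C a) * q) * (C l + X * q) * G = u ^ 2 * derivative A z ^ 2 := by
      refine mul_left_cancel₀ hT ?_
      have e1 : z = X * (C l + (X - 4 * C a) * q) := by rw [hzq, seriesOfQ_eq]; ring
      have e2 : z - 4 * C b = (X - 4 * C a) * (C l + X * q) := by rw [hH, hH']
      rw [e2] at heq
      linear_combination -heq - (X - 4 * C a) * (C l + X * q) * G * e1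
    have e : defect l a u (trunc n (v ^ 2)) q =
        -((C l + (X - 4 * C a) * q) * (C l + X * q) *
          (G - Polynomial.aeval z (trunc n (v ^ 2)))) := by
      rw [defect, wVal, ← seriesOfQ_eq, dSeries, ← hzq]
      linear_combination hfull
    rw [e]
    exact (happrox.mul_left _).neg_right

theorem isoSolve_ensures (hK : Function.Injective (algebraMap A K)) {ϖ : A} {k e ℓ : ℕ} {ν : A}
    (h : IsPrecision ϖ k e ℓ ν) {n : ℕ} (hn : 1 ≤ n) (hℓ : ∀ i < n - 1, binWeight i ≤ ℓ)
    {U V : K⟦X⟧} (hU : HasFactorization A U) (hV : HasFactorization A V) {z : A⟦X⟧}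
    (hz : IsNonzeroSolution U V (PowerSeries.map (algebraMap A K) z)) :
    (isoSolve ϖ k U V n).Ensures fun out =>
      ∀ i < n, ∀ x : A, reduce ϖ k x = coeff i out → 8 * ν ∣ x - coeff i z := by
  rw [isoSolve]
  obtain ⟨a, u, hau⟩ := hU
  obtain ⟨b, v, hbv⟩ := hV
  have hpre : (precompute ϖ k U V n).Ensures fun D => ∃ (a : A) (u : A⟦X⟧) (b : A) (v : A⟦X⟧),
      IsFactorization U a u ∧ IsFactorization V b v ∧ D = solverData ϖ k n a u b v :=
    Run.ensures_choose ⟨_, a, u, b, v, hau, hbv, rfl⟩ fun D hD => hD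
  refine hpre.bind ?_
  clear hau hbv a b u v
  rintro _ ⟨a, u, b, v, hau, hbv, rfl⟩
  have hu : IsUnit u := isUnit_iff_constantCoeff.2 hau.2.1
  obtain ⟨hz0, hzne, heq⟩ := integral_equation hK hau hbv hz
  obtain ⟨l, q, hl, hzq, hs⟩ := exists_isSolutionMod hau.1 hbv.1 hu
    (isUnit_iff_constantCoeff.2 hbv.2.1) hz0 hzne heq (n - 1)
  have hD := isSolverData_solverData ϖ k n (v := v) hu hl hn
  refine (diffSolve_ensures h hs hℓ hD (n - 1) le_rfl).bind ?_
  rintro ⟨x, r⟩ ⟨hx, -⟩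
  dsimp only at hx ⊢
  refine (h.fixedDiv_l_ensures hD hau.1).bind ?_
  rintro _ rfl
  refine Run.ensures_pure ?_
  rw [hD.a_eq]
  obtain ⟨x, rfl⟩ := PowerSeries.map_surjective (reduce ϖ k) reduce_surjective x
  have hx' := X_pow_dvd_map_defect_iff.1 hx
  rw [coeffIdeal_eq_of_associated h.associated] at hx'
  have hxq : x - q ∈ coeffIdeal (8 * ν) (n - 1) :=
    hs.mem_coeffIdeal_of_defect h.isUnit_one_add_two_mul hℓ le_rfl (by rwa [add_sub_cancel])
  have hser : seriesOfQ l a x - z ∈ coeffIdeal (8 * ν) n := by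
    have e : seriesOfQ l a x - z = X * ((X - 4 * C a) * (x - q)) := by
      rw [hzq, seriesOfQ_eq, seriesOfQ_eq]; ring
    rw [e]
    rintro (_ | i) hi
    · simp
    · rw [coeff_succ_X_mul]
      exact Ideal.mul_mem_left _ _ hxq i (by omega)
  intro i hi y hy
  rw [coeff_truncT, if_pos hi, ← map_seriesOfQ, coeff_map, reduce_eq_iff] at hy
  have h1 : 8 * ν ∣ y - coeff i (seriesOfQ l a x) :=
    (dvd_trans (Dvd.intro_left _ rfl) h.associated.symm.dvd).trans hy
  have h2 := hser i hi
  rw [map_sub] at h2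
  rw [← sub_add_sub_cancel y (coeff i (seriesOfQ l a x))]
  exact dvd_add h1 h2

end Solution

/-! ### The ring of integers of an algebraic extension of `ℚ_[2]` -/

section RingOfInt

/-- By integrality every maximal ideal lies over `(2)`, so `2` belongs to all of them. -/
theorem isUnit_one_add_two_mul_of_isIntegral {S : Type*} [CommRing S] [Algebra ℤ_[2] S]
    [Algebra.IsIntegral ℤ_[2] S] (x : S) : IsUnit (1 + 2 * x) := by
  by_contra h
  obtain ⟨I, hI, hx⟩ := exists_max_ideal_of_mem_nonunits (mem_nonunits_iff.2 h)
  have hmax := Ideal.isMaximal_comap_of_isIntegral_of_isMaximal (R := ℤ_[2]) I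
  have h2 : (2 : ℤ_[2]) ∈ I.comap (algebraMap ℤ_[2] S) := by
    rw [IsLocalRing.eq_maximalIdeal hmax, PadicInt.maximalIdeal_eq_span_p]
    exact Ideal.subset_span (by simp)
  rw [Ideal.mem_comap, map_ofNat] at h2
  exact hI.ne_top ((Ideal.eq_top_iff_one I).2
    ((Ideal.add_mem_iff_left I (I.mul_mem_right x h2)).1 hx))

variable {K : Type*} [Field K] [Algebra ℚ_[2] K]

theorem isUnit_one_add_two_mul_ringOfInt (x : ringOfInt K) : IsUnit (1 + 2 * x) := by
  let : Algebra ℤ_[2] K := ((algebraMap ℚ_[2] K).comp (algebraMap ℤ_[2] ℚ_[2])).toAlgebra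
  exact isUnit_one_add_two_mul_of_isIntegral (S := integralClosure ℤ_[2] K) x

theorem charZero_ringOfInt : CharZero (ringOfInt K) := by
  have : CharZero K := charZero_of_injective_algebraMap (algebraMap ℚ_[2] K).injective
  exact ⟨fun m n h => Nat.cast_injective (R := K) (by
    have := congrArg (Subtype.val) h
    simpa using this)⟩

end RingOfInt

end

/-! ### The theorem: choice of the precision parameters -/

theorem theorem1 (K : Type*) [Field K] [Algebra ℚ_[2] K] [Algebra.IsAlgebraic ℚ_[2] K]
    -- a uniformizer, and the ramification index
    (ϖ : ringOfInt K) (hϖ : Irreducible ϖ)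
    (e : ℕ) (he : Associated (2 : ringOfInt K) (ϖ ^ e))
    (n : ℕ) (hn : 1 ≤ n)
    -- the target precision `N = j / e` and the working precision `M = k / e`
    (N M : ℚ) (j k : ℕ) (hj : (j : ℚ) = e * N)
    (hM : M = max N 3 + (Nat.log 2 n : ℚ) + 2) (hk : (k : ℚ) = e * M)
    (U V : PowerSeries K)
    (hU : HasFactorization (ringOfInt K) U) (hV : HasFactorization (ringOfInt K) V)
    (z : PowerSeries (ringOfInt K))
    (hz : IsNonzeroSolution U V (PowerSeries.map (algebraMap (ringOfInt K) K) z)) :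
    -- no execution raises an error, and there is an execution
    ¬ (isoSolve ϖ k U V n).HasOutcome none ∧
    (∃ out, (isoSolve ϖ k U V n).HasOutcome (some out)) ∧
    -- the output of every execution is correct modulo `(2 ^ N, t ^ n)`
    ∀ out, (isoSolve ϖ k U V n).HasOutcome (some out) →
      ∀ i < n, ∀ x : ringOfInt K, reduce ϖ k x = PowerSeries.coeff i out →
        ϖ ^ j ∣ x - PowerSeries.coeff i z := by
  have := charZero_ringOfInt (K := K)
  have h2 := isUnit_one_add_two_mul_ringOfInt (K := K)
  have htwo : ¬ IsUnit (2 : ringOfInt K) := by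
    intro h
    obtain ⟨v, hv⟩ := h.exists_right_inv
    have := h2 (-v)
    rw [mul_neg, hv, add_neg_cancel] at this
    exact not_isUnit_zero this
  have he0 : 1 ≤ e := by
    rcases Nat.eq_zero_or_pos e with rfl | h
    · rw [pow_zero] at he
      exact absurd (associated_one_iff_isUnit.1 he) htwo
    · exact h
  set ℓ := Nat.log 2 n with hℓ
  -- `j'` is `e * max N 3`; the bound `3` makes `ϖ ^ j'` a multiple of `8`, so that it can be
  -- written `8 * ν`.
  obtain ⟨j', hj'⟩ : ∃ j', j' = max j (3 * e) := ⟨_, rfl⟩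
  have hk' : k = j' + e * (ℓ + 2) := by
    have h1 : (e : ℚ) * max N 3 = max (j : ℚ) (3 * e) := by
      rw [mul_max_of_nonneg _ _ (Nat.cast_nonneg e), hj, mul_comm (3 : ℚ)]
    have h3 : (k : ℚ) = ((j' + e * (ℓ + 2) : ℕ) : ℚ) := by
      rw [hk, hM, hj']
      push_cast
      rw [← h1]; ring
    exact_mod_cast h3
  have hj3 : 3 * e ≤ j' := hj' ▸ le_max_right _ _
  have hjj : j ≤ j' := hj' ▸ le_max_left _ _
  obtain ⟨c, hc⟩ := he
  have h8 : 8 * ((c : ringOfInt K) ^ 3 * ϖ ^ (j' - 3 * e)) = ϖ ^ j' := by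
    have h3 : (ϖ ^ e) ^ 3 * ϖ ^ (j' - 3 * e) = ϖ ^ j' := by
      rw [← pow_mul, ← pow_add]; congr 1; omega
    rw [← h3, ← hc]; ring
  have hprec : IsPrecision ϖ k e ℓ ((c : ringOfInt K) ^ 3 * ϖ ^ (j' - 3 * e)) := by
    refine ⟨hϖ.not_isUnit, hϖ.ne_zero, ⟨c, hc⟩, by rw [hk']; nlinarith, h2, ?_⟩
    rw [h8, hk', pow_add, mul_comm, pow_mul]
    exact (Associated.pow_pow (Associated.symm ⟨c, hc⟩)).mul_right _
  -- `q` is needed only in degrees `i < n - 1`, where `2 ^ binWeight i ≤ i + 1 ≤ n`.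
  have hdigits : ∀ i < n - 1, binWeight i ≤ ℓ := fun i hi =>
    Nat.le_log_of_pow_le one_lt_two ((two_pow_binWeight_le i).trans (by omega))
  obtain ⟨h1, h3, h4⟩ := isoSolve_ensures (A := ringOfInt K) (K := K) Subtype.val_injective hprec hn
    hdigits hU hV hz
  refine ⟨h1, h3, fun out hout i hi x hx => ?_⟩
  have := h4 out hout i hi x hx
  rw [h8] at this
  exact (pow_dvd_pow ϖ hjj).trans this
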